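/- Conventions. A multiplicative lattice is a complete lattice $L$ with bottom $0$ and top $1$ that is also a commutative monoid with identity $1$, such that $a\left(\bigvee_\alpha b_\alpha\right)=\bigvee_\alpha (ab_\alpha)$ for all $a,b_\alpha\in L$. Put $(y:x)=\bigvee\{a\in L : ax\le y\}$. An element $x\in L$ is principal if $y\wedge zx=((y:x)\wedge z)x$ and $y\vee(z:x)=((yx\vee z):x)$ for all $y,z\in L$. An element $p\neq 1$ is prime if $xy\le p$ implies $x\le p$ or $y\le p$. An element $c$ is compact if $c\le\bigvee S$ implies $c\le\bigvee T$ for some finite $T\subseteq S$. A $C$-lattice is a multiplicative lattice in which $1$ is compact, products of compact elements are compact, and every element is a join of compact elements. A maximal element is a maximal element of $L\setminus\{1\}$. For a prime $p$, let $$x_p=\bigvee\{a\in L : a \text{ compact and } as\le x \text{ for some compact } s\not\le p\},$$ and let $L_p=\{x_p : x\in L\}$, with the order induced from $L$ and the multiplication $(x,y)\mapsto (xy)_p$. The lattice $L$ is sharp if whenever $a_1a_2\le b$ in $L$ there are $b_1,b_2\in L$ with $b=b_1b_2$, $a_1\le b_1$ and $a_2\le b_2$. An isomorphism is an order isomorphism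 that preserves multiplication. Let $\mathbb{Z}_-$ be the set of integers $\le 0$ together with $-\infty$, with the usual order and with addition as multiplication. Let $\mathbb{R}_1$ be the set of all intervals $[r,\infty]$ and $(r,\infty]$ with $r\in\mathbb{R}$, $r\ge 0$, together with $\{\infty\}$, ordered by inclusion and with the interval addition $S+T=\{s+t : s\in S,\ t\in T\}$ as multiplication. Theorem. Let $L\neq\{0,1\}$ be a $C$-lattice in which $0$ is a prime element and every element is a join of principal elements. Assume that $L$ has finite character, that is, every nonzero element of $L$ is below only finitely many maximal elements. Then the following are equivalent: (i) $L$ is sharp. (ii) For every maximal element $m$ of $L$, the localization $L_m$ is isomorphic to $\mathbb{Z}_-$ or to $\mathbb{R}_1$. -/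

import Mathlib

open scoped Pointwise ENNReal NNReal

namespace MultLattice

/-- A multiplicative lattice: a complete lattice that is a commutative monoid whose identity is
the top element and whose multiplication distributes over arbitrary joins.  The elements written
`0` and `1` in the literature are `⊥` and `⊤ = 1` here. -/
class IsMultiplicativeLattice (L : Type*) [CompleteLattice L] [CommMonoid L] : Prop
    extends IsQuantale L where
  one_eq_top : (1 : L) = ⊤

/-- A `C`-lattice: the top element is compact, compact elements are closed under
multiplication, and every element is a join of compact elements. -/
class IsCLattice (L : Type*) [CompleteLattice L] [CommMonoid L] : Prop
    extends IsMultiplicativeLattice L, IsCompactlyGenerated L where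
  isCompact_top : IsCompactElement (⊤ : L)
  isCompact_mul : ∀ a b : L, IsCompactElement a → IsCompactElement b → IsCompactElement (a * b)

section

variable {L : Type*} [CompleteLattice L] [CommMonoid L]

/-- The residual `(y : x)`, the join of all `a` with `a * x ≤ y`. -/
def residual (y x : L) : L := sSup {a | a * x ≤ y}

/-- Meet-principal elements. -/
def IsMeetPrincipal (x : L) : Prop :=
  ∀ y z : L, y ⊓ z * x = (residual y x ⊓ z) * x

/-- Join-principal elements. -/
def IsJoinPrincipal (x : L) : Prop :=
  ∀ y z : L, y ⊔ residual z x = residual (y * x ⊔ z) x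

/-- Principal elements. -/
def IsPrincipal (x : L) : Prop := IsMeetPrincipal x ∧ IsJoinPrincipal x

/-- Prime elements. -/
def IsPrime (p : L) : Prop := p ≠ ⊤ ∧ ∀ x y : L, x * y ≤ p → x ≤ p ∨ y ≤ p

variable (L) in
/-- Lattice domains: the bottom element is prime. -/
def IsLatticeDomain : Prop := IsPrime (⊥ : L)

variable (L) in
/-- Every element is a join of principal elements. -/
def IsPrincipallyGenerated : Prop :=
  ∀ a : L, ∃ S : Set L, (∀ x ∈ S, IsPrincipal x) ∧ sSup S = a

variable (L) in
/-- Sharp lattices. -/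
def IsSharp : Prop :=
  ∀ a₁ a₂ b : L, a₁ * a₂ ≤ b → ∃ b₁ b₂ : L, b = b₁ * b₂ ∧ a₁ ≤ b₁ ∧ a₂ ≤ b₂

variable (L) in
/-- Finite character: every nonzero element is below only finitely many maximal elements. -/
def HasFiniteCharacter : Prop :=
  ∀ x : L, x ≠ ⊥ → {m : L | IsCoatom m ∧ x ≤ m}.Finite

/-- The localization `x_p` of an element `x` at `p`. -/
def localize (p x : L) : L :=
  sSup {a | IsCompactElement a ∧ ∃ s : L, IsCompactElement s ∧ ¬ s ≤ p ∧ a * s ≤ x}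

/-- The localization `L_p = {x_p | x ∈ L}` of the lattice at `p`. -/
def LocalizedLattice (p : L) : Type _ := {y : L // ∃ x : L, localize p x = y}

/-- `L_p` carries the order of `L`. -/
instance (p : L) : PartialOrder (LocalizedLattice p) :=
  inferInstanceAs (PartialOrder {y : L // ∃ x : L, localize p x = y})

/-- The product of `x` and `y` in `L_p` is `(x * y)_p`. -/
instance (p : L) : Mul (LocalizedLattice p) :=
  ⟨fun x y => ⟨localize p (x.1 * y.1), x.1 * y.1, rfl⟩⟩

end

/-- The lattice `ℤ₋`: the integers `≤ 0` together with `-∞`, with the usual order. -/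
def ZMinus : Type := {x : WithBot ℤ // x ≤ 0}

instance : PartialOrder ZMinus := inferInstanceAs (PartialOrder {x : WithBot ℤ // x ≤ 0})

/-- The multiplication of `ℤ₋` is the usual addition. -/
instance : Mul ZMinus := ⟨fun x y => ⟨x.1 + y.1, add_nonpos x.2 y.2⟩⟩

/-- The underlying sets of `ℝ₁`: the intervals `[r, ∞]` and `(r, ∞]` with `r ≥ 0` real,
and `{∞}`. -/
def IsROneInterval (S : Set ℝ≥0∞) : Prop :=
  (∃ r : ℝ≥0, S = Set.Icc (r : ℝ≥0∞) ⊤) ∨ (∃ r : ℝ≥0, S = Set.Ioc (r : ℝ≥0∞) ⊤) ∨ S = {⊤}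

theorem Icc_add_Icc_top (r t : ℝ≥0) :
    Set.Icc (r : ℝ≥0∞) ⊤ + Set.Icc (t : ℝ≥0∞) ⊤ = Set.Icc ((r + t : ℝ≥0) : ℝ≥0∞) ⊤ := by
  ext z
  simp only [Set.mem_add, Set.mem_Icc, le_top, and_true, ENNReal.coe_add]
  constructor
  · rintro ⟨x, hx, y, hy, rfl⟩
    exact add_le_add hx hy
  · intro hz
    exact ⟨z - t, ENNReal.le_sub_of_add_le_right ENNReal.coe_ne_top hz, t, le_rfl,
      tsub_add_cancel_of_le (le_trans le_add_self hz)⟩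

theorem Ioc_add_Icc_top (r t : ℝ≥0) :
    Set.Ioc (r : ℝ≥0∞) ⊤ + Set.Icc (t : ℝ≥0∞) ⊤ = Set.Ioc ((r + t : ℝ≥0) : ℝ≥0∞) ⊤ := by
  ext z
  simp only [Set.mem_add, Set.mem_Icc, Set.mem_Ioc, le_top, and_true, ENNReal.coe_add]
  constructor
  · rintro ⟨x, hx, y, hy, rfl⟩
    exact ENNReal.add_lt_add_of_lt_of_le ENNReal.coe_ne_top hx hy
  · intro hz
    exact ⟨z - t, lt_tsub_iff_right.2 hz, t, le_rfl,
      tsub_add_cancel_of_le (le_trans le_add_self hz.le)⟩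

theorem Ioc_add_Ioc_top (r t : ℝ≥0) :
    Set.Ioc (r : ℝ≥0∞) ⊤ + Set.Ioc (t : ℝ≥0∞) ⊤ = Set.Ioc ((r + t : ℝ≥0) : ℝ≥0∞) ⊤ := by
  ext z
  simp only [Set.mem_add, Set.mem_Ioc, le_top, and_true, ENNReal.coe_add]
  constructor
  · rintro ⟨x, hx, y, hy, rfl⟩
    exact ENNReal.add_lt_add hx hy
  · intro hz
    have h : (t : ℝ≥0∞) < z - r := lt_tsub_iff_right.2 (by rwa [add_comm])
    obtain ⟨y, hty, hyz⟩ := exists_between h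
    have hyr : y + r < z := lt_tsub_iff_right.1 hyz
    exact ⟨z - y, lt_tsub_iff_right.2 (by rwa [add_comm]), y, hty,
      tsub_add_cancel_of_le (le_trans le_self_add hyr.le)⟩

theorem top_add_of_nonempty {S : Set ℝ≥0∞} (h : S.Nonempty) : ({⊤} : Set ℝ≥0∞) + S = {⊤} := by
  ext z
  obtain ⟨y, hy⟩ := h
  simp only [Set.mem_add, Set.mem_singleton_iff]
  constructor
  · rintro ⟨x, rfl, y, _, rfl⟩
    exact top_add y
  · rintro rfl
    exact ⟨⊤, rfl, y, hy, top_add y⟩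

theorem IsROneInterval.nonempty {S : Set ℝ≥0∞} (h : IsROneInterval S) : S.Nonempty := by
  rcases h with ⟨r, rfl⟩ | ⟨r, rfl⟩ | rfl
  · exact ⟨⊤, by simp⟩
  · exact ⟨⊤, by simp⟩
  · exact ⟨⊤, rfl⟩

theorem IsROneInterval.add {S T : Set ℝ≥0∞} (hS : IsROneInterval S) (hT : IsROneInterval T) :
    IsROneInterval (S + T) := by
  rcases hS with ⟨r, rfl⟩ | ⟨r, rfl⟩ | rfl
  · rcases hT with ⟨t, rfl⟩ | ⟨t, rfl⟩ | rfl
    · exact Or.inl ⟨_, Icc_add_Icc_top r t⟩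
    · exact Or.inr (Or.inl ⟨_, by rw [add_comm, Ioc_add_Icc_top t r]⟩)
    · exact Or.inr (Or.inr (by rw [add_comm, top_add_of_nonempty ⟨⊤, by simp⟩]))
  · rcases hT with ⟨t, rfl⟩ | ⟨t, rfl⟩ | rfl
    · exact Or.inr (Or.inl ⟨_, Ioc_add_Icc_top r t⟩)
    · exact Or.inr (Or.inl ⟨_, Ioc_add_Ioc_top r t⟩)
    · exact Or.inr (Or.inr (by rw [add_comm, top_add_of_nonempty ⟨⊤, by simp⟩]))
  · exact Or.inr (Or.inr (top_add_of_nonempty hT.nonempty))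

/-- The lattice `ℝ₁`, ordered by inclusion. -/
def ROne : Type := {S : Set ℝ≥0∞ // IsROneInterval S}

instance : PartialOrder ROne := inferInstanceAs (PartialOrder {S : Set ℝ≥0∞ // IsROneInterval S})

/-- The multiplication of `ℝ₁` is the interval addition `{x + y | x ∈ S, y ∈ T}`. -/
instance : Mul ROne := ⟨fun S T => ⟨S.1 + T.1, S.2.add T.2⟩⟩

end MultLattice

namespace MultLattice

/-! Forward direction. Sharpness passes to a localization at a maximal element, so the work takes
place in a lattice where every element other than `⊤` lies below one `m`. There a nonzero principal
element belongs to every set whose join it is, and factors of nonzero principal elements are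
principal. Factoring `y ≥ a * (y : a)` with `y` principal, nonzero and below `a` produces a least
principal element above `a` (`exists_principal_eq_mul_residual`); applied to `x ⊔ y` this acts as a
gcd. A Nakayama argument excludes coprime pairs of proper principals, so principal elements form a
chain (`IsPrincipal.le_or_le`).

The nonzero principals are therefore a totally ordered cancellative monoid with division and with
suprema of nonempty sets. Completeness forces the Archimedean property. If there is a largest
element below `1`, the monoid is `ℕ`; otherwise Hölder's embedding, density and completeness
identify it with `ℝ≥0`, the order being reversed in both cases. An element `a` of the lattice is
determined by the upper set of parameters of the principals below it, multiplication becomes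
Minkowski addition of upper sets, and `ℤ₋` and `ℝ₁` are exactly the lattices of upper sets of `ℕ`
and `ℝ≥0`.

Converse. Both models are sharp by direct computation, so `b` factors as required in each
localization. By finite character only finitely many maximal elements lie above a nonzero `b`, and
the meets of the local factors over these are the global factors. This works because a nonzero local
factor at `m` lies below no other maximal element (`not_le_of_archimedeanPowers`), so localizing the
meet recovers each local factor, and equality can be tested locally (`le_of_forall_localize_le`). -/

theorem mul_ne_bot {L : Type*} [CompleteLattice L] [CommMonoid L] (hdom : IsLatticeDomain L)
    {x y : L} (hx : x ≠ ⊥) (hy : y ≠ ⊥) : x * y ≠ ⊥ := fun h => by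
  rcases hdom.2 x y h.le with h | h
  · exact hx (le_bot_iff.1 h)
  · exact hy (le_bot_iff.1 h)

theorem top_mem_of_sSup_eq_top {L : Type*} [CompleteLattice L] {m : L} (hm : m ≠ ⊤)
    (hloc : ∀ x : L, x ≠ ⊤ → x ≤ m) {S : Set L}
    (h : sSup S = ⊤) : ⊤ ∈ S := by
  by_contra hS
  refine hm (top_le_iff.1 (h ▸ sSup_le fun x hx => hloc x ?_))
  rintro rfl
  exact hS hx

/-! ### Residuals and cancellation of principal elements. -/

section Residual

variable {L : Type*} [CompleteLattice L] [CommMonoid L] [IsMultiplicativeLattice L]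

theorem le_one' (a : L) : a ≤ 1 := by
  rw [IsMultiplicativeLattice.one_eq_top]; exact le_top

theorem mul_mono {a b c d : L} (h : a ≤ b) (h' : c ≤ d) : a * c ≤ b * d :=
  mul_le_mul' h h'

theorem mul_le_left (a b : L) : a * b ≤ a := by
  simpa using mul_mono (le_refl a) (le_one' b)

theorem mul_le_right (a b : L) : a * b ≤ b := by
  simpa using mul_mono (le_one' a) (le_refl b)

theorem residual_mul_le (y x : L) : residual y x * x ≤ y := by
  rw [residual, IsQuantale.sSup_mul_distrib]
  exact iSup₂_le fun _ h => h

theorem le_residual_iff {a y x : L} : a ≤ residual y x ↔ a * x ≤ y :=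
  ⟨fun h => (mul_mono h le_rfl).trans (residual_mul_le y x), fun h => le_sSup h⟩

theorem residual_mono {y z : L} (h : y ≤ z) (x : L) : residual y x ≤ residual z x :=
  le_residual_iff.2 ((residual_mul_le y x).trans h)

theorem residual_anti (y : L) {x z : L} (h : x ≤ z) : residual y z ≤ residual y x :=
  le_residual_iff.2 ((mul_mono le_rfl h).trans (residual_mul_le y z))

theorem le_residual (y x : L) : y ≤ residual y x := le_residual_iff.2 (mul_le_left y x)

theorem residual_residual (y a b : L) : residual (residual y a) b = residual y (a * b) :=
  eq_of_forall_le_iff fun c => by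
    simp only [le_residual_iff]
    rw [mul_assoc, mul_comm b a]

theorem residual_sup (y a b : L) : residual y (a ⊔ b) = residual y a ⊓ residual y b :=
  eq_of_forall_le_iff fun c => by
    simp only [le_residual_iff, le_inf_iff, Quantale.mul_sup_distrib, sup_le_iff]

theorem residual_eq_top_iff {y x : L} : residual y x = ⊤ ↔ x ≤ y := by
  rw [← top_le_iff, le_residual_iff, ← IsMultiplicativeLattice.one_eq_top, one_mul]

theorem residual_eq_of_le {y x : L} (h : x ≤ y) : residual y x = ⊤ := residual_eq_top_iff.2 h

theorem residual_one (y : L) : residual y 1 = y :=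
  eq_of_forall_le_iff fun c => by rw [le_residual_iff, mul_one]

theorem isPrincipal_one : IsPrincipal (1 : L) :=
  ⟨fun y z => by simp [residual_one], fun y z => by simp [residual_one]⟩

theorem IsPrincipal.mul {a b : L} (ha : IsPrincipal a) (hb : IsPrincipal b) :
    IsPrincipal (a * b) := by
  refine ⟨fun y z => ?_, fun y z => ?_⟩
  · rw [← residual_residual, ← mul_assoc, mul_right_comm, ha.1, hb.1, mul_assoc, mul_comm b a]
  · rw [← residual_residual, hb.2, ha.2, residual_residual, mul_assoc, mul_comm b a]

theorem IsPrincipal.residual_mul_self {x y : L} (hx : IsPrincipal x) (h : y ≤ x) :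
    residual y x * x = y := by
  have := hx.1 y ⊤
  rw [inf_top_eq, ← IsMultiplicativeLattice.one_eq_top, one_mul, inf_eq_left.2 h] at this
  exact this.symm

theorem residual_bot (hdom : IsLatticeDomain L) {x : L} (hx : x ≠ ⊥) : residual ⊥ x = ⊥ := by
  rcases hdom.2 _ _ (residual_mul_le ⊥ x) with h | h
  · exact le_bot_iff.1 h
  · exact absurd (le_bot_iff.1 h) hx

theorem IsPrincipal.residual_mul_cancel (hdom : IsLatticeDomain L) {x : L} (hx : IsPrincipal x)
    (h0 : x ≠ ⊥) (y : L) : residual (y * x) x = y := by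
  have := hx.2 y ⊥
  rw [residual_bot hdom h0, sup_bot_eq, sup_bot_eq] at this
  exact this.symm

theorem IsPrincipal.le_of_mul_le_mul (hdom : IsLatticeDomain L) {x a b : L} (hx : IsPrincipal x)
    (h0 : x ≠ ⊥) (h : a * x ≤ b * x) : a ≤ b := by
  rwa [← le_residual_iff, hx.residual_mul_cancel hdom h0] at h

end Residual

/-! ### Sharp quasi-local domains: principal elements form a chain. -/

section LocalSharp

variable {L : Type*} [CompleteLattice L] [CommMonoid L] [IsMultiplicativeLattice L] {m : L}

/-- Dividing by `x` turns the join into one equal to `⊤`, and in the quasi-local case such a join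
must contain `⊤`. -/
theorem IsPrincipal.mem_of_sSup_eq (hdom : IsLatticeDomain L) (hm : m ≠ ⊤)
    (hloc : ∀ x : L, x ≠ ⊤ → x ≤ m) {x : L} (hx : IsPrincipal x) (h0 : x ≠ ⊥) {S : Set L}
    (h : sSup S = x) : x ∈ S := by
  have hS : ∀ y ∈ S, y ≤ x := fun y hy => h ▸ le_sSup hy
  have h1 : sSup ((residual · x) '' S) = ⊤ := by
    rw [← top_le_iff, ← IsMultiplicativeLattice.one_eq_top]
    refine hx.le_of_mul_le_mul hdom h0 ?_
    rw [one_mul]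
    conv_lhs => rw [← h]
    refine sSup_le fun y hy => ?_
    conv_lhs => rw [← hx.residual_mul_self (hS y hy)]
    exact mul_mono (le_sSup ⟨y, hy, rfl⟩) le_rfl
  obtain ⟨y, hy, hyx⟩ := top_mem_of_sSup_eq_top hm hloc h1
  rwa [le_antisymm (residual_eq_top_iff.1 hyx) (hS y hy)]

/-- Write `a` and `b` as joins of principals. Join irreducibility of `a * b` selects principals `p ≤
a` and `q ≤ b` with `p * q = a * b`; cancelling `q` from `a * q ≤ p * q` gives `a = p`. -/
theorem IsPrincipal.of_mul_left (hdom : IsLatticeDomain L) (hgen : IsPrincipallyGenerated L)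
    (hm : m ≠ ⊤) (hloc : ∀ x : L, x ≠ ⊤ → x ≤ m) {a b : L} (hx : IsPrincipal (a * b))
    (h0 : a * b ≠ ⊥) : IsPrincipal a := by
  obtain ⟨S, hS, hSa⟩ := hgen a
  obtain ⟨T, hT, hTb⟩ := hgen b
  have h1 : sSup ((· * b) '' S) = a * b := by
    rw [sSup_image, ← IsQuantale.sSup_mul_distrib, hSa]
  obtain ⟨p, hp, hpx⟩ := hx.mem_of_sSup_eq hdom hm hloc h0 h1
  have h2 : sSup ((p * ·) '' T) = a * b := by
    rw [sSup_image, ← IsQuantale.mul_sSup_distrib, hTb]; exact hpx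
  obtain ⟨q, hq, hqx⟩ := hx.mem_of_sSup_eq hdom hm hloc h0 h2
  have hq0 : q ≠ ⊥ := by
    rintro rfl
    exact h0 (hqx.symm.trans Quantale.mul_bot)
  have hap : a ≤ p := by
    refine (hT q hq).le_of_mul_le_mul hdom hq0 ?_
    exact (mul_mono le_rfl (hTb ▸ le_sSup hq)).trans hqx.ge
  rw [le_antisymm hap (hSa ▸ le_sSup hp)]
  exact hS p hp

theorem exists_principal_eq_mul_residual (hdom : IsLatticeDomain L)
    (hgen : IsPrincipallyGenerated L) (hsharp : IsSharp L) (hm : m ≠ ⊤)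
    (hloc : ∀ x : L, x ≠ ⊤ → x ≤ m) {a y : L} (hy : IsPrincipal y) (h0 : y ≠ ⊥) (hya : y ≤ a) :
    ∃ d, IsPrincipal d ∧ a ≤ d ∧ y = d * residual y a ∧
      ∀ e, IsPrincipal e → a ≤ e → d ≤ e := by
  obtain ⟨d, c, rfl, had, hc⟩ := hsharp a (residual y a) y
    (by rw [mul_comm]; exact residual_mul_le y a)
  have hca : c = residual (d * c) a := by
    refine le_antisymm (le_residual_iff.2 ?_) hc
    rw [mul_comm]
    exact mul_mono had le_rfl
  have hcp : IsPrincipal c := by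
    rw [mul_comm] at hy h0
    exact hy.of_mul_left hdom hgen hm hloc h0
  have hc0 : c ≠ ⊥ := by
    rintro rfl
    exact h0 Quantale.mul_bot
  refine ⟨d, hy.of_mul_left hdom hgen hm hloc h0, had, by rw [← hca], fun e he hae => ?_⟩
  -- Since `a ≤ e`, the cofactor of `e` in `y` is at most `c = (y : a)`; hence `d * c = y ≤ e * c`,
  -- and `c` cancels.
  refine hcp.le_of_mul_le_mul hdom hc0 ?_
  conv_lhs => rw [← he.residual_mul_self (hya.trans hae), mul_comm]
  refine mul_mono le_rfl ((residual_anti _ hae).trans hca.ge)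

/-- The hypothesis `h` says that `x` and `y` are coprime. Sharpness applied to `(x ⊔ y)² ≤ x² ⊔ y`
gives factors that must both equal `x ⊔ y`, so `y ≤ (x ⊔ y)² ≤ m * y ⊔ x²`. Nakayama then yields `y
≤ x² ≤ x`, which is incompatible with coprimality unless `x = ⊤`. -/
theorem eq_one_or_eq_one_of_residual_eq_self (hdom : IsLatticeDomain L)
    (hsharp : IsSharp L) (hloc : ∀ x : L, x ≠ ⊤ → x ≤ m) (hm : m ≠ ⊤)
    {x y : L} (hx : IsPrincipal x) (hy : IsPrincipal y) (hy0 : y ≠ ⊥)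
    (h : residual y x = y) : x = ⊤ ∨ y = ⊤ := by
  by_contra! hne
  have hsup : residual (x * x ⊔ y) x = x ⊔ y := by rw [← hx.2, h]
  obtain ⟨b, c, hbc, hb, hc⟩ := hsharp (x ⊔ y) (x ⊔ y) (x * x ⊔ y) (by
    rw [Quantale.sup_mul_distrib, Quantale.mul_sup_distrib]
    exact sup_le (sup_le_sup le_rfl (mul_le_right x y)) ((mul_le_left _ _).trans le_sup_right))
  have hb' : b ≤ x ⊔ y := by
    rw [← hsup, le_residual_iff, hbc]
    exact mul_mono le_rfl (le_sup_left.trans hc)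
  have hc' : c ≤ x ⊔ y := by
    rw [← hsup, le_residual_iff, hbc, mul_comm]
    exact mul_mono (le_sup_left.trans hb) le_rfl
  have hxm := hloc x hne.1
  have hym := hloc y hne.2
  have h1 : y ≤ m * y ⊔ x * x := by
    calc y ≤ b * c := hbc ▸ le_sup_right
      _ ≤ (x ⊔ y) * (x ⊔ y) := mul_mono hb' hc'
      _ = (x * x ⊔ x * y) ⊔ (y * x ⊔ y * y) := by
        rw [Quantale.sup_mul_distrib, Quantale.mul_sup_distrib, Quantale.mul_sup_distrib]
      _ ≤ _ := by
        have hxy : x * y ≤ m * y := mul_mono hxm le_rfl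
        have hyy : y * y ≤ m * y := mul_mono hym le_rfl
        exact sup_le (sup_le le_sup_right (hxy.trans le_sup_left))
          (sup_le ((mul_comm y x).le.trans (hxy.trans le_sup_left)) (hyy.trans le_sup_left))
  -- Nakayama step: join-principality of `y` divides the inequality by `y`, and `m` cannot
  -- contribute to a join equal to `⊤`.
  have h2 : m ⊔ residual (x * x) y = ⊤ := by rw [hy.2, residual_eq_top_iff]; exact h1
  have h3 : y ≤ x * x := by
    rw [← residual_eq_top_iff]
    by_contra h4
    rw [sup_eq_left.2 (hloc _ h4)] at h2
    exact hm h2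
  have h4 : residual y x ≤ y := h.le
  have h5 : y ≤ x := h3.trans (mul_le_left x x)
  have h6 : residual y x * x = y := hx.residual_mul_self h5
  rw [h] at h6
  refine hne.1 (top_le_iff.1 ?_)
  rw [← IsMultiplicativeLattice.one_eq_top]
  refine hy.le_of_mul_le_mul hdom hy0 ?_
  rw [one_mul, mul_comm, h6]

theorem IsPrincipal.le_or_le (hdom : IsLatticeDomain L)
    (hgen : IsPrincipallyGenerated L) (hsharp : IsSharp L) (hm : m ≠ ⊤)
    (hloc : ∀ x : L, x ≠ ⊤ → x ≤ m) {x y : L} (hx : IsPrincipal x) (hy : IsPrincipal y) :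
    x ≤ y ∨ y ≤ x := by
  rcases eq_or_ne y ⊥ with rfl | hy0
  · exact Or.inr bot_le
  rcases eq_or_ne x ⊥ with rfl | hx0
  · exact Or.inl bot_le
  obtain ⟨d, hd, hxyd, hyd, -⟩ :=
    exists_principal_eq_mul_residual hdom hgen hsharp hm hloc hy hy0 (le_sup_right : y ≤ x ⊔ y)
  have hd0 : d ≠ ⊥ := by
    rintro rfl
    exact hy0 (le_bot_iff.1 (le_sup_right.trans hxyd))
  rw [residual_sup, residual_eq_of_le le_rfl, inf_top_eq] at hyd
  have hx' := hd.residual_mul_self (le_sup_left.trans hxyd)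
  have hxp : IsPrincipal (residual x d) := by
    rw [← hx'] at hx hx0
    exact hx.of_mul_left hdom hgen hm hloc hx0
  have hyp : IsPrincipal (residual y x) := by
    rw [hyd, mul_comm] at hy hy0
    exact hy.of_mul_left hdom hgen hm hloc hy0
  -- Here `d` is the gcd: `residual x d` is `x / d`, and by `hyd` `residual y x` is `y / d`. The
  -- claim is that these quotients are coprime.
  have key : residual (residual y x) (residual x d) = residual y x := by
    refine le_antisymm ?_ (le_residual _ _)
    rw [le_residual_iff]
    calc residual (residual y x) (residual x d) * x
        = residual (residual y x) (residual x d) * residual x d * d := by rw [mul_assoc, hx']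
      _ ≤ residual y x * d := mul_mono (residual_mul_le _ _) le_rfl
      _ = y := by rw [mul_comm, ← hyd]
  rcases eq_one_or_eq_one_of_residual_eq_self hdom hsharp hloc hm hxp hyp
    (fun h => hy0 (by rw [hyd, h, Quantale.mul_bot])) key with h | h
  · right
    rw [← IsMultiplicativeLattice.one_eq_top] at h
    rw [h, one_mul] at hx'
    rw [← hx']
    exact le_sup_right.trans hxyd
  · left
    exact residual_eq_top_iff.1 h

end LocalSharp

/-! ### Complete totally ordered monoids with division: `ℕ` or `ℝ≥0`. -/

section OrderedMonoid

variable {P : Type*} [CommMonoid P] [LinearOrder P] [IsOrderedCancelMonoid P]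

theorem exists_pow_le_of_isLUB (hdiv : ∀ p q : P, p ≤ q → ∃ r, p = r * q)
    (hlub : ∀ S : Set P, S.Nonempty → ∃ b, IsLUB S b) {p : P} (hp : p < 1) (q : P) :
    ∃ n : ℕ, p ^ n ≤ q := by
  by_contra! h
  -- Take the greatest lower bound `b` of the powers of `p`. Dividing it by `p` gives another lower
  -- bound `c`, so `c ≤ b = c * p`, contradicting `p < 1`.
  obtain ⟨b, hb⟩ := hlub {r | ∀ n : ℕ, r ≤ p ^ n} ⟨q, fun n => (h n).le⟩
  have hbn : ∀ n : ℕ, b ≤ p ^ n := fun n => hb.2 fun r hr => hr n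
  obtain ⟨c, rfl⟩ := hdiv b p (by simpa using hbn 1)
  have hc : c ≤ c * p := hb.1 fun n => by
    have := hbn (n + 1)
    rwa [pow_succ, mul_le_mul_iff_right] at this
  rw [le_mul_iff_one_le_right'] at hc
  exact hp.not_ge hc

theorem exists_nat_param (h1 : ∀ p : P, p ≤ 1) (hdiv : ∀ p q : P, p ≤ q → ∃ r, p = r * q)
    (harch : ∀ p q : P, p < 1 → ∃ n : ℕ, p ^ n ≤ q) {t : P} (ht : t < 1)
    (hmax : ∀ q : P, q < 1 → q ≤ t) :
    ∃ g : ℕ → P, (∀ r s, g (r + s) = g r * g s) ∧ (∀ r s, g r ≤ g s ↔ s ≤ r) ∧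
      Function.Surjective g := by
  have hanti : StrictAnti fun n : ℕ => t ^ n := strictAnti_nat_of_succ_lt fun n => by
    rw [pow_succ]
    exact mul_lt_of_lt_one_right' _ ht
  have hle : ∀ r s : ℕ, t ^ r ≤ t ^ s ↔ s ≤ r := fun r s => hanti.le_iff_ge
  refine ⟨fun n => t ^ n, pow_add t, hle, fun p => ?_⟩
  classical
  -- The least such `n` gives `t ^ (n + 1) < p ≤ t ^ n`. The quotient `r = p / t ^ n` is then `1`,
  -- because `r < 1` would mean `r ≤ t`.
  have hex : ∃ n : ℕ, t ^ (n + 1) < p := by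
    obtain ⟨n, hn⟩ := harch t p ht
    exact ⟨n, lt_of_lt_of_le (hanti n.lt_succ_self) hn⟩
  have hlt := Nat.find_spec hex
  have hpn : p ≤ t ^ Nat.find hex := by
    rcases h : Nat.find hex with _ | k
    · simpa using h1 p
    · exact not_lt.1 (Nat.find_min hex (by omega : k < Nat.find hex))
  obtain ⟨r, hr⟩ := hdiv _ _ hpn
  refine ⟨Nat.find hex, ?_⟩
  rcases (h1 r).lt_or_eq with h | h
  · refine absurd hlt (not_lt.2 ?_)
    rw [pow_succ']
    conv_lhs => rw [hr]
    exact mul_le_mul_left (hmax r h) _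
  · rw [h, one_mul] at hr
    exact hr.symm

/-- A fraction `b / t > 1` is the inverse of `r = t / b < 1`, and `a / s ≤ 1 / s`, so a power of `r`
below `s` suffices. -/
theorem mulArchimedean_grothendieckGroup (h1 : ∀ p : P, p ≤ 1)
    (hdiv : ∀ p q : P, p ≤ q → ∃ r, p = r * q)
    (harch : ∀ p q : P, p < 1 → ∃ n : ℕ, p ^ n ≤ q) :
    MulArchimedean (Algebra.GrothendieckGroup P) := by
  refine ⟨fun x y hy => ?_⟩
  induction x using Localization.induction_on with | _ x
  induction y using Localization.induction_on with | _ y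
  obtain ⟨a, s⟩ := x
  obtain ⟨b, t⟩ := y
  rw [← Localization.mk_one, Localization.mk_lt_mk] at hy
  simp only [OneMemClass.coe_one, one_mul, mul_one] at hy
  obtain ⟨r, hr⟩ := hdiv _ _ hy.le
  have hr1 : r < 1 := by
    refine lt_of_not_ge fun h => hy.not_ge ?_
    rw [hr]
    exact le_mul_of_one_le_left' h
  obtain ⟨n, hn⟩ := harch r s hr1
  refine ⟨n, ?_⟩
  rw [Localization.mk_pow, Localization.mk_le_mk]
  simp only [SubmonoidClass.coe_pow]
  rw [hr, mul_pow, mul_right_comm, mul_right_comm]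
  exact (mul_le_of_le_one_right' (h1 a)).trans (mul_le_mul_left hn _)

theorem exists_real_valuation (h1 : ∀ p : P, p ≤ 1)
    (hdiv : ∀ p q : P, p ≤ q → ∃ r, p = r * q)
    (harch : ∀ p q : P, p < 1 → ∃ n : ℕ, p ^ n ≤ q) :
    ∃ v : P → ℝ, (∀ p q, v (p * q) = v p + v q) ∧ ∀ p q, v p ≤ v q ↔ q ≤ p := by
  have := mulArchimedean_grothendieckGroup h1 hdiv harch
  obtain ⟨f, hf⟩ := Archimedean.exists_orderAddMonoidHom_real_injective
    (Additive (Algebra.GrothendieckGroup P))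
  -- The sign makes values nonnegative on elements `≤ 1`, so `v` reverses the order.
  refine ⟨fun p => - f (.ofMul (Algebra.GrothendieckGroup.of p)), fun p q => ?_, fun p q => ?_⟩
  · simp only [map_mul, ofMul_mul, map_add, neg_add]
  · rw [neg_le_neg_iff, (StrictMono.le_iff_le (f := f) (f.monotone'.strictMono_of_injective hf)), Additive.ofMul_le]
    simp only [Algebra.GrothendieckGroup.of]
    erw [← Localization.mk_one_eq_monoidOf_mk, ← Localization.mk_one_eq_monoidOf_mk,
      Localization.mk_le_mk]
    simp

theorem exists_nnreal_param [Nontrivial P] (h1 : ∀ p : P, p ≤ 1)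
    (hdiv : ∀ p q : P, p ≤ q → ∃ r, p = r * q)
    (hlub : ∀ S : Set P, S.Nonempty → ∃ b, IsLUB S b)
    (hdense : ∀ p : P, p < 1 → ∃ q, p < q ∧ q < 1) :
    ∃ g : ℝ≥0 → P, (∀ r s, g (r + s) = g r * g s) ∧ (∀ r s, g r ≤ g s ↔ s ≤ r) ∧
      Function.Surjective g := by
  obtain ⟨v, hmul, hle⟩ := exists_real_valuation h1 hdiv
    fun p q hp => exists_pow_le_of_isLUB hdiv hlub hp q
  have hv1 : v 1 = 0 := by simpa using hmul 1 1
  have hlt : ∀ p q, v p < v q ↔ q < p := fun p q => lt_iff_lt_of_le_iff_le (hle q p)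
  have hinj : Function.Injective v := fun p q h =>
    le_antisymm ((hle q p).1 h.ge) ((hle p q).1 h.le)
  have h0 : ∀ p, 0 ≤ v p := fun p => by rw [← hv1, hle]; exact h1 p
  have hpow : ∀ p (n : ℕ), v (p ^ n) = n * v p := fun p n => by
    induction n with
    | zero => simp [hv1]
    | succ k ih => rw [pow_succ, hmul, ih]; push_cast; ring
  -- Split `p = r * q` with both factors below `1`; the one of smaller value has at most half the
  -- value of `p`.
  have hhalf : ∀ p, p < 1 → ∃ q, q < 1 ∧ 2 * v q ≤ v p := fun p hp => by
    obtain ⟨q, hpq, hq⟩ := hdense p hp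
    obtain ⟨r, rfl⟩ := hdiv p q hpq.le
    have hr : r < 1 := lt_of_le_of_ne (h1 r) fun h => by simp [h] at hpq
    rw [hmul]
    rcases le_total (v q) (v r) with h | h
    · exact ⟨q, hq, by linarith⟩
    · exact ⟨r, hr, by linarith⟩
  obtain ⟨t, ht⟩ : ∃ t : P, t < 1 := by
    obtain ⟨t, ht⟩ := exists_ne (1 : P)
    exact ⟨t, lt_of_le_of_ne (h1 t) ht⟩
  have hsmall : ∀ n : ℕ, ∃ q, q < 1 ∧ 2 ^ n * v q ≤ v t := fun n => by
    induction n with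
    | zero => exact ⟨t, ht, by simp⟩
    | succ k ih =>
      obtain ⟨q, hq, hk⟩ := ih
      obtain ⟨r, hr, hrq⟩ := hhalf q hq
      refine ⟨r, hr, le_trans ?_ hk⟩
      rw [pow_succ, mul_assoc]
      gcongr
  have heps : ∀ ε : ℝ, 0 < ε → ∃ q, 0 < v q ∧ v q < ε := fun ε hε => by
    obtain ⟨n, hn⟩ := pow_unbounded_of_one_lt (v t / ε) one_lt_two
    obtain ⟨q, hq, hqn⟩ := hsmall n
    refine ⟨q, by rwa [← hv1, hlt], ?_⟩
    rw [div_lt_iff₀ hε] at hn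
    exact lt_of_mul_lt_mul_left (hqn.trans_lt hn) (by positivity)
  have hbtw : ∀ a b : ℝ, 0 ≤ a → a < b → ∃ q, a < v q ∧ v q < b := fun a b ha hab => by
    obtain ⟨q, hq, hqe⟩ := heps (b - a) (sub_pos.2 hab)
    -- The first multiple of `v q` beyond `a`; since `v q < b - a`, it has not yet reached `b`.
    refine ⟨q ^ (⌊a / v q⌋₊ + 1), ?_, ?_⟩
    · rw [hpow, ← div_lt_iff₀ hq]
      exact_mod_cast Nat.lt_floor_add_one (a / v q)
    · rw [hpow]
      have := (le_div_iff₀ hq).1 (Nat.floor_le (div_nonneg ha hq.le))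
      push_cast
      linarith
  have hsurj : ∀ r : ℝ≥0, ∃ p, v p = r := fun r => by
    have hS : {p | (r : ℝ) ≤ v p}.Nonempty := by
      obtain ⟨q, hq, -⟩ := hbtw r (r + 1) r.2 (lt_add_one _)
      exact ⟨q, hq.le⟩
    -- As `v` reverses order, the supremum `b` has the least possible value; density of the values
    -- on both sides of `r` forces `v b = r`.
    obtain ⟨b, hb⟩ := hlub _ hS
    refine ⟨b, le_antisymm ?_ ?_⟩
    · by_contra! h
      obtain ⟨q, hq, hqb⟩ := hbtw _ _ r.2 h
      exact hqb.not_ge ((hle b q).2 (hb.1 hq.le))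
    · by_contra! h
      obtain ⟨q, hbq, hq⟩ := hbtw _ _ (h0 b) h
      refine hbq.not_ge ((hle q b).2 (hb.2 fun s hs => ?_))
      exact (hle q s).1 (hq.le.trans hs)
  choose g hg using hsurj
  refine ⟨g, fun r s => hinj ?_, fun r s => ?_, fun p => ⟨⟨v p, h0 p⟩, hinj (hg _)⟩⟩
  · rw [hmul, hg, hg, hg, NNReal.coe_add]
  · rw [← hle, hg, hg, NNReal.coe_le_coe]

end OrderedMonoid

/-! ### `ℤ₋` and `ℝ₁` as lattices of upper sets of `ℕ` and `ℝ≥0`. -/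

section Models

/-- The `n : ℕ` with `-n ≤ x`. -/
def ZMinus.upper (x : ZMinus) : Set ℕ := {n | ((-(n : ℤ) : ℤ) : WithBot ℤ) ≤ x.1}

/-- The finite elements of an interval in `ℝ₁`. -/
def ROne.upper (S : ROne) : Set ℝ≥0 := {r | (r : ℝ≥0∞) ∈ S.1}

theorem ZMinus.isUpperSet_upper (x : ZMinus) : IsUpperSet x.upper := fun n k h hn => by
  refine le_trans ?_ (show ((-(n : ℤ) : ℤ) : WithBot ℤ) ≤ x.1 from hn)
  rw [WithBot.coe_le_coe]
  omega

theorem ZMinus.eq_bot_or (x : ZMinus) :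
    x.1 = ⊥ ∨ ∃ n : ℕ, x.1 = ((-(n : ℤ) : ℤ) : WithBot ℤ) := by
  obtain ⟨x, hx⟩ := x
  induction x using WithBot.recBotCoe with
  | bot => exact Or.inl rfl
  | coe z =>
    have hz : z ≤ 0 := by exact_mod_cast hx
    exact Or.inr ⟨z.natAbs, by simp only [WithBot.coe_inj]; omega⟩

theorem ZMinus.upper_of_eq_bot {x : ZMinus} (h : x.1 = ⊥) : x.upper = ∅ := by
  ext n
  simp [ZMinus.upper, h]

theorem ZMinus.upper_of_eq {x : ZMinus} {n : ℕ} (h : x.1 = ((-(n : ℤ) : ℤ) : WithBot ℤ)) :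
    x.upper = Set.Ici n := by
  ext k
  simp only [ZMinus.upper, h, WithBot.coe_le_coe, Set.mem_ofPred_eq, Set.mem_Ici]
  omega

theorem ZMinus.le_iff (x y : ZMinus) : x ≤ y ↔ x.upper ⊆ y.upper := by
  refine ⟨fun h n hn => le_trans (b := x.1) hn h, fun h => ?_⟩
  rcases x.eq_bot_or with hx | ⟨n, hx⟩
  · change x.1 ≤ y.1
    rw [hx]
    exact bot_le
  · have : n ∈ y.upper := h (by rw [ZMinus.upper_of_eq hx]; exact Set.mem_Ici.2 le_rfl)
    change x.1 ≤ y.1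
    rw [hx]
    exact this

theorem ZMinus.upper_mul (x y : ZMinus) : (x * y).upper = x.upper + y.upper := by
  have hxy : (x * y).1 = x.1 + y.1 := rfl
  rcases x.eq_bot_or with hx | ⟨n, hx⟩
  · rw [ZMinus.upper_of_eq_bot hx, Set.empty_add, ZMinus.upper_of_eq_bot]
    rw [hxy, hx, WithBot.bot_add]
  rcases y.eq_bot_or with hy | ⟨k, hy⟩
  · rw [ZMinus.upper_of_eq_bot hy, Set.add_empty, ZMinus.upper_of_eq_bot]
    rw [hxy, hy, WithBot.add_bot]
  rw [ZMinus.upper_of_eq hx, ZMinus.upper_of_eq hy, ZMinus.upper_of_eq (n := n + k)]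
  · ext u
    simp only [Set.mem_Ici, Set.mem_add]
    exact ⟨fun h => ⟨n, le_rfl, u - n, by omega, by omega⟩, by rintro ⟨a, ha, b, hb, rfl⟩; omega⟩
  · rw [hxy, hx, hy, ← WithBot.coe_add, WithBot.coe_inj]
    push_cast
    ring

theorem ZMinus.exists_upper_eq (S : Set ℕ) (hS : IsUpperSet S) : ∃ x : ZMinus, x.upper = S := by
  classical
  rcases S.eq_empty_or_nonempty with rfl | h
  · exact ⟨⟨⊥, bot_le⟩, ZMinus.upper_of_eq_bot rfl⟩
  · have h' : ∃ n, n ∈ S := h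
    obtain ⟨x, hx⟩ : ∃ x : ZMinus, x.1 = ((-(Nat.find h' : ℤ) : ℤ) : WithBot ℤ) :=
      ⟨⟨_, show _ ≤ ((0 : ℤ) : WithBot ℤ) from WithBot.coe_le_coe.2 (by omega)⟩, rfl⟩
    refine ⟨x, ?_⟩
    rw [ZMinus.upper_of_eq hx]
    ext k
    exact ⟨fun hk => hS hk (Nat.find_spec h'), fun hk => Nat.find_min' h' hk⟩

theorem ROne.top_mem (S : ROne) : (⊤ : ℝ≥0∞) ∈ S.1 := by
  rcases S.2 with ⟨r, h⟩ | ⟨r, h⟩ | h <;> simp [h]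

theorem ROne.isUpperSet (S : ROne) : IsUpperSet S.1 := by
  rcases S.2 with ⟨r, h⟩ | ⟨r, h⟩ | h <;> rw [h]
  · rw [Set.Icc_top]; exact isUpperSet_Ici _
  · rw [Set.Ioc_top]; exact isUpperSet_Ioi _
  · rw [← Set.Ici_top]; exact isUpperSet_Ici _

theorem ROne.isUpperSet_upper (S : ROne) : IsUpperSet S.upper := fun _ _ h hr =>
  S.isUpperSet (ENNReal.coe_le_coe.2 h) hr

theorem ROne.le_iff (S T : ROne) : S ≤ T ↔ S.upper ⊆ T.upper := by
  refine ⟨fun h r hr => h hr, fun h z hz => ?_⟩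
  induction z with
  | top => exact T.top_mem
  | coe r => exact h hz

theorem ROne.upper_mul (S T : ROne) : (S * T).upper = S.upper + T.upper := by
  ext u
  have : (S * T).1 = S.1 + T.1 := rfl
  simp only [ROne.upper, this, Set.mem_add, Set.mem_ofPred_eq]
  constructor
  · rintro ⟨x, hx, y, hy, hu⟩
    lift x to ℝ≥0 using fun h => by simp [h] at hu
    lift y to ℝ≥0 using fun h => by simp [h] at hu
    exact ⟨x, hx, y, hy, by exact_mod_cast hu⟩
  · rintro ⟨x, hx, y, hy, rfl⟩
    exact ⟨x, hx, y, hy, by push_cast; rfl⟩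

theorem ROne.exists_upper_eq (S : Set ℝ≥0) (hS : IsUpperSet S) : ∃ x : ROne, x.upper = S := by
  rcases S.eq_empty_or_nonempty with rfl | h
  · exact ⟨⟨{⊤}, Or.inr (Or.inr rfl)⟩, by ext; simp [ROne.upper]⟩
  have hlt : ∀ u, sInf S < u → u ∈ S := fun u hu => by
    obtain ⟨s, hs, hsu⟩ := exists_lt_of_csInf_lt h hu
    exact hS hsu.le hs
  by_cases hmem : sInf S ∈ S
  · refine ⟨⟨Set.Icc (sInf S : ℝ≥0) ⊤, Or.inl ⟨_, rfl⟩⟩, ?_⟩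
    ext u
    simp only [ROne.upper, Set.mem_Icc, le_top, and_true, Set.mem_ofPred_eq, ENNReal.coe_le_coe]
    exact ⟨fun hu => hS hu hmem, fun hu => csInf_le (OrderBot.bddBelow S) hu⟩
  · refine ⟨⟨Set.Ioc (sInf S : ℝ≥0) ⊤, Or.inr (Or.inl ⟨_, rfl⟩)⟩, ?_⟩
    ext u
    simp only [ROne.upper, Set.mem_Ioc, le_top, and_true, Set.mem_ofPred_eq, ENNReal.coe_lt_coe]
    refine ⟨hlt u, fun hu => lt_of_le_of_ne (csInf_le (OrderBot.bddBelow S) hu) ?_⟩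
    rintro rfl
    exact hmem hu

end Models

/-! ### Reconstructing the lattice from its parametrized principal elements. -/

section Param

variable {L : Type*} [CompleteLattice L] {Γ : Type*}

/-- If `r ∉ S`, every element of `S` is at least `r`, so the join is squeezed to `g r`; join
irreducibility then puts `r` in `S` after all. -/
theorem mem_of_le_sSup_image [LinearOrder Γ] {g : Γ → L} (hle : ∀ r s, g r ≤ g s ↔ s ≤ r)
    (hjoin : ∀ r S, sSup S = g r → g r ∈ S) {S : Set Γ} (hS : IsUpperSet S) {r : Γ}
    (h : g r ≤ sSup (g '' S)) : r ∈ S := by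
  by_contra hr
  have hlt : ∀ s ∈ S, r ≤ s := fun s hs => le_of_not_ge fun hsr => hr (hS hsr hs)
  have : sSup (g '' S) = g r := le_antisymm
    (sSup_le (by rintro _ ⟨s, hs, rfl⟩; exact (hle _ _).2 (hlt s hs))) h
  obtain ⟨s, hs, hsr⟩ := hjoin r _ this
  exact hr (hS ((hle _ _).1 hsr.ge) hs)

theorem sSup_image_mul_sSup_image [CommMonoid L] [IsMultiplicativeLattice L] [AddCommMonoid Γ]
    {g : Γ → L} (hadd : ∀ r s, g (r + s) = g r * g s)
    (S T : Set Γ) :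
    sSup (g '' S) * sSup (g '' T) = sSup (g '' (S + T)) := by
  apply le_antisymm
  · rw [IsQuantale.sSup_mul_distrib]
    refine iSup₂_le ?_
    rintro _ ⟨s, hs, rfl⟩
    rw [IsQuantale.mul_sSup_distrib]
    refine iSup₂_le ?_
    rintro _ ⟨t, ht, rfl⟩
    exact le_sSup ⟨s + t, Set.add_mem_add hs ht, hadd s t⟩
  · refine sSup_le ?_
    rintro _ ⟨_, ⟨s, hs, t, ht, rfl⟩, rfl⟩
    rw [hadd]
    exact mul_mono (le_sSup ⟨s, hs, rfl⟩) (le_sSup ⟨t, ht, rfl⟩)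

theorem sSup_image_le_eq [CommMonoid L] {g : Γ → L} (hgen : IsPrincipallyGenerated L)
    (hsurj : ∀ p : L, IsPrincipal p → p ≠ ⊥ → ∃ r, g r = p) (a : L) :
    sSup (g '' {r | g r ≤ a}) = a := by
  apply le_antisymm
  · refine sSup_le ?_
    rintro _ ⟨r, hr, rfl⟩
    exact hr
  · obtain ⟨S, hS, rfl⟩ := hgen a
    refine sSup_le fun p hp => ?_
    rcases eq_or_ne p ⊥ with rfl | h0
    · exact bot_le
    obtain ⟨r, rfl⟩ := hsurj p (hS p hp) h0
    exact le_sSup ⟨r, le_sSup hp, rfl⟩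

/-- Stated for any model `X` of the upper sets of `Γ`, so that the discrete and the dense case share
one argument. -/
theorem nonempty_mulOrderIso_of_param [CommMonoid L] [IsMultiplicativeLattice L]
    [AddCommMonoid Γ] [LinearOrder Γ] {g : Γ → L} (hgen : IsPrincipallyGenerated L)
    (hadd : ∀ r s, g (r + s) = g r * g s) (hle : ∀ r s, g r ≤ g s ↔ s ≤ r)
    (hjoin : ∀ r S, sSup S = g r → g r ∈ S)
    (hsurj : ∀ p : L, IsPrincipal p → p ≠ ⊥ → ∃ r, g r = p)
    {X : Type*} [PartialOrder X] [Mul X] (U : X → Set Γ) (hU : ∀ x, IsUpperSet (U x))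
    (hUle : ∀ x y, x ≤ y ↔ U x ⊆ U y) (hUmul : ∀ x y, U (x * y) = U x + U y)
    (hUsurj : ∀ S, IsUpperSet S → ∃ x, U x = S) : Nonempty (L ≃*o X) := by
  have hmono : ∀ x y, sSup (g '' U x) ≤ sSup (g '' U y) ↔ x ≤ y := fun x y => by
    rw [hUle]
    exact ⟨fun h r hr => mem_of_le_sSup_image hle hjoin (hU y) 
      ((le_sSup (Set.mem_image_of_mem g hr)).trans h),
      fun h => sSup_le_sSup (Set.image_mono h)⟩
  let F : X →ₙ* L := ⟨fun x => sSup (g '' U x), fun x y => by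
    rw [sSup_image_mul_sSup_image hadd, hUmul]⟩
  have hF : Function.Bijective F := by
    refine ⟨fun x y h => le_antisymm ((hmono x y).1 h.le) ((hmono y x).1 h.ge), fun a => ?_⟩
    obtain ⟨x, hx⟩ := hUsurj {r | g r ≤ a} fun r s hrs hr => ((hle _ _).2 hrs).trans hr
    refine ⟨x, ?_⟩
    change sSup (g '' U x) = a
    rw [hx]
    exact sSup_image_le_eq hgen hsurj a
  let e : X ≃*o L := ⟨MulEquiv.ofBijective F hF, fun {x y} => hmono x y⟩
  exact ⟨e.symm⟩

end Param

/-! ### Classification in the quasi-local case. -/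

section LocalClassification

variable {L : Type*} [CompleteLattice L] [CommMonoid L] [IsMultiplicativeLattice L] {m : L}

/-- The monoid of nonzero principal elements of a lattice domain. -/
def nonzeroPrincipals (hdom : IsLatticeDomain L) : Submonoid L where
  carrier := {p | IsPrincipal p ∧ p ≠ ⊥}
  mul_mem' ha hb := ⟨ha.1.mul hb.1, mul_ne_bot hdom ha.2 hb.2⟩
  one_mem' := ⟨isPrincipal_one, fun h => hdom.1 (by
    rw [← h, IsMultiplicativeLattice.one_eq_top])⟩

theorem isSharp_local_classification (hdom : IsLatticeDomain L)
    (hgen : IsPrincipallyGenerated L) (hsharp : IsSharp L) (hm : m ≠ ⊤) (hm0 : m ≠ ⊥)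
    (hloc : ∀ x : L, x ≠ ⊤ → x ≤ m) : Nonempty (L ≃*o ZMinus) ∨ Nonempty (L ≃*o ROne) := by
  classical
  let _ : LinearOrder (nonzeroPrincipals hdom) :=
    { (inferInstance : PartialOrder (nonzeroPrincipals hdom)) with
      le_total := fun p q => p.2.1.le_or_le hdom hgen hsharp hm hloc q.2.1
      toDecidableLE := Classical.decRel _ }
  have : IsOrderedCancelMonoid (nonzeroPrincipals hdom) :=
    { mul_le_mul_left := fun a b h c => mul_mono (L := L) h le_rfl
      le_of_mul_le_mul_left := fun a b c h => by
        have h' : (a * b : L) ≤ a * c := h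
        rw [mul_comm (a : L), mul_comm (a : L)] at h'
        exact a.2.1.le_of_mul_le_mul hdom a.2.2 h' }
  have h1 : ∀ p : nonzeroPrincipals hdom, p ≤ 1 := fun p => le_one' (p : L)
  have hdiv : ∀ p q : nonzeroPrincipals hdom, p ≤ q → ∃ r, p = r * q := fun p q h => by
    have hr := q.2.1.residual_mul_self (y := (p : L)) h
    have hp := p.2
    refine ⟨⟨residual p q, ?_, fun h => ?_⟩, Subtype.ext hr.symm⟩
    · exact IsPrincipal.of_mul_left (b := (q : L)) hdom hgen hm hloc (hr.symm ▸ p.2.1)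
        (hr.symm ▸ p.2.2)
    · rw [h, Quantale.bot_mul] at hr
      exact p.2.2 hr.symm
  have hlub : ∀ S : Set (nonzeroPrincipals hdom), S.Nonempty → ∃ b, IsLUB S b := by
    rintro S ⟨y, hy⟩
    -- The join of `S` in the lattice need not be principal; the supremum among principals is the
    -- least principal element above it.
    obtain ⟨d, hd, had, hyd, hmin⟩ := exists_principal_eq_mul_residual hdom hgen hsharp hm hloc
      y.2.1 y.2.2 (le_sSup ⟨y, hy, rfl⟩ : (y : L) ≤ sSup ((↑) '' S))
    have hd0 : d ≠ ⊥ := by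
      rintro rfl
      exact y.2.2 (hyd.trans Quantale.bot_mul)
    refine ⟨⟨d, hd, hd0⟩, 
      fun p hp => (le_sSup (Set.mem_image_of_mem Subtype.val hp)).trans had, fun e he => ?_⟩
    refine hmin e e.2.1 (sSup_le ?_)
    rintro _ ⟨p, hp, rfl⟩
    exact he hp
  obtain ⟨t, ht⟩ : ∃ t : nonzeroPrincipals hdom, t < 1 := by
    obtain ⟨S, hS, rfl⟩ := hgen m
    obtain ⟨t, htS, ht0⟩ : ∃ t ∈ S, t ≠ ⊥ := by
      by_contra! h
      exact hm0 (le_bot_iff.1 (sSup_le fun t ht => (h t ht).le))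
    refine ⟨⟨t, hS t htS, ht0⟩, lt_of_le_of_ne (h1 _) fun h => hm (top_le_iff.1 ?_)⟩
    rw [← IsMultiplicativeLattice.one_eq_top]
    exact (congrArg Subtype.val h).ge.trans (le_sSup htS)
  have hjoin : ∀ (p : nonzeroPrincipals hdom) (S : Set L), sSup S = p → (p : L) ∈ S :=
    fun p S h => p.2.1.mem_of_sSup_eq hdom hm hloc p.2.2 h
  by_cases hdense : ∀ p : nonzeroPrincipals hdom, p < 1 → ∃ q, p < q ∧ q < 1
  · right
    have : Nontrivial (nonzeroPrincipals hdom) := ⟨t, 1, ht.ne⟩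
    obtain ⟨g, hadd, hle, hsurj⟩ := exists_nnreal_param h1 hdiv hlub hdense
    exact nonempty_mulOrderIso_of_param (g := fun r => (g r : L)) hgen
      (fun r s => congrArg Subtype.val (hadd r s)) hle (fun r => hjoin (g r))
      (fun p hp h0 => (hsurj ⟨p, hp, h0⟩).imp fun r hr => congrArg Subtype.val hr)
      ROne.upper ROne.isUpperSet_upper ROne.le_iff ROne.upper_mul ROne.exists_upper_eq
  · left
    push Not at hdense
    obtain ⟨s, hs, hmax⟩ := hdense
    obtain ⟨g, hadd, hle, hsurj⟩ := exists_nat_param h1 hdiv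
      (fun p q hp => exists_pow_le_of_isLUB hdiv hlub hp q) hs
      (fun q hq => not_lt.1 fun h => (hmax q h).not_gt hq)
    exact nonempty_mulOrderIso_of_param (g := fun r => (g r : L)) hgen
      (fun r s => congrArg Subtype.val (hadd r s)) hle (fun r => hjoin (g r))
      (fun p hp h0 => (hsurj ⟨p, hp, h0⟩).imp fun r hr => congrArg Subtype.val hr)
      ZMinus.upper ZMinus.isUpperSet_upper ZMinus.le_iff ZMinus.upper_mul ZMinus.exists_upper_eq

end LocalClassification

/-! ### Localization of elements at a prime. -/

section LocalizeBasic

variable {L : Type*} [CompleteLattice L]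

theorem isCompactElement_bot : IsCompactElement (⊥ : L) := by
  rw [CompleteLattice.isCompactElement_iff_le_of_directed_sSup_le]
  exact fun S ⟨x, hx⟩ _ _ => ⟨x, hx, bot_le⟩

theorem isCompactElement_sup {a b : L} (ha : IsCompactElement a) (hb : IsCompactElement b) :
    IsCompactElement (a ⊔ b) := by
  rw [CompleteLattice.isCompactElement_iff_le_of_directed_sSup_le] at *
  intro S hS hdir h
  obtain ⟨x, hx, hax⟩ := ha S hS hdir (le_sup_left.trans h)
  obtain ⟨y, hy, hby⟩ := hb S hS hdir (le_sup_right.trans h)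
  obtain ⟨z, hz, hxz, hyz⟩ := hdir x hx y hy
  exact ⟨z, hz, sup_le (hax.trans hxz) (hby.trans hyz)⟩

variable [CommMonoid L] {p : L}

theorem localize_mono (p : L) {x y : L} (h : x ≤ y) : localize p x ≤ localize p y :=
  sSup_le_sSup fun _ ⟨ha, s, hs, hsp, has⟩ => ⟨ha, s, hs, hsp, has.trans h⟩

theorem localize_le_of_le (hp : IsPrime p) {x : L} (h : x ≤ p) : localize p x ≤ p :=
  sSup_le fun _ ⟨_, _, _, hsp, has⟩ => (hp.2 _ _ (has.trans h)).resolve_right hsp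

theorem localize_bot (hdom : IsLatticeDomain L) (p : L) : localize p ⊥ = ⊥ :=
  le_bot_iff.1 (sSup_le fun _ ⟨_, _, _, hsp, has⟩ =>
    (hdom.2 _ _ has).resolve_right fun h => hsp (h.trans bot_le))

theorem LocalizedLattice.val_mul (x y : LocalizedLattice p) :
    (x * y).1 = localize p (x.1 * y.1) := rfl

end LocalizeBasic

section Localize

variable {L : Type*} [CompleteLattice L] [CommMonoid L] [IsCLattice L]

/-- For directed `S` with `x ≤ sSup S`, meet-continuity and meet-principality express `x` as a join
of the elements `(y : x) * x`. Cancelling `x` gives a directed cover of `⊤`, which is compact. -/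
theorem IsPrincipal.isCompactElement (hdom : IsLatticeDomain L) {x : L} (hx : IsPrincipal x) :
    IsCompactElement x := by
  rcases eq_or_ne x ⊥ with rfl | h0
  · exact isCompactElement_bot
  rw [CompleteLattice.isCompactElement_iff_le_of_directed_sSup_le]
  intro S hS hdir hle
  have h1 : (⊤ : L) ≤ sSup ((residual · x) '' S) := by
    rw [← IsMultiplicativeLattice.one_eq_top]
    refine hx.le_of_mul_le_mul hdom h0 ?_
    rw [one_mul]
    conv_lhs => rw [← inf_eq_left.2 hle, hdir.inf_sSup_eq]
    refine iSup₂_le fun y hy => ?_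
    have h2 := hx.1 y 1
    rw [one_mul, IsMultiplicativeLattice.one_eq_top, inf_top_eq] at h2
    rw [inf_comm, h2]
    exact mul_mono (le_sSup ⟨y, hy, rfl⟩) le_rfl
  obtain ⟨_, ⟨y, hy, rfl⟩, hyx⟩ :=
    (CompleteLattice.isCompactElement_iff_le_of_directed_sSup_le _ _).1
      (IsCLattice.isCompact_top (L := L)) _ (hS.image _)
      (hdir.mono_comp fun a b h => residual_mono h x) h1
  exact ⟨y, hy, residual_eq_top_iff.1 (top_le_iff.1 hyx)⟩

theorem exists_isCompactElement_le_not_le {x p : L} (h : ¬ x ≤ p) :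
    ∃ s, IsCompactElement s ∧ s ≤ x ∧ ¬ s ≤ p := by
  rw [le_iff_compact_le_imp] at h
  push Not at h
  exact h

theorem isPrime_of_isCoatom {m : L} (hm : IsCoatom m) : IsPrime m := by
  refine ⟨hm.1, fun x y h => ?_⟩
  by_contra! hxy
  have hx : x ⊔ m = 1 := by
    rw [IsMultiplicativeLattice.one_eq_top]; exact hm.2 _ (right_lt_sup.2 hxy.1)
  have hy : y ⊔ m = 1 := by
    rw [IsMultiplicativeLattice.one_eq_top]; exact hm.2 _ (right_lt_sup.2 hxy.2)
  refine hm.1 (top_le_iff.1 ?_)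
  have hxy1 : (x ⊔ m) * (y ⊔ m) = 1 := by rw [hx, hy, one_mul]
  rw [← IsMultiplicativeLattice.one_eq_top, ← hxy1, Quantale.sup_mul_distrib, Quantale.mul_sup_distrib]
  exact sup_le (sup_le h (mul_le_right _ _)) (mul_le_left _ _)

variable {p : L}

theorem le_localize_of_mul_le {z s x : L} (hs : ¬ s ≤ p) (h : z * s ≤ x) : z ≤ localize p x := by
  obtain ⟨t, ht, hts, htp⟩ := exists_isCompactElement_le_not_le hs
  rw [le_iff_compact_le_imp]
  exact fun c hc hcz => le_sSup ⟨hc, t, ht, htp, (mul_mono hcz hts).trans h⟩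

/-- The join defining `localize` is directed: for two elements, the product of their denominators
serves as a common one, and primality keeps it outside `p`. A compact `a` thus needs only one
denominator. -/
theorem le_localize_iff (hp : IsPrime p) {a x : L} (ha : IsCompactElement a) :
    a ≤ localize p x ↔ ∃ s, IsCompactElement s ∧ ¬ s ≤ p ∧ a * s ≤ x := by
  refine ⟨fun h => ?_, fun ⟨s, _, hs, h⟩ => le_localize_of_mul_le hs h⟩
  obtain ⟨b, ⟨-, s, hs, hsp, hbs⟩, hab⟩ :=
    (CompleteLattice.isCompactElement_iff_le_of_directed_sSup_le _ _).1 ha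
      {a | IsCompactElement a ∧ ∃ s : L, IsCompactElement s ∧ ¬ s ≤ p ∧ a * s ≤ x}
      ⟨⊥, isCompactElement_bot, ⊤, IsCLattice.isCompact_top,
        fun h => hp.1 (top_le_iff.1 h), by rw [Quantale.bot_mul]; exact bot_le⟩
      (by
        rintro b ⟨hb, s, hs, hsp, hbs⟩ c ⟨hc, t, ht, htp, hct⟩
        refine ⟨b ⊔ c, ⟨isCompactElement_sup hb hc, s * t, IsCLattice.isCompact_mul s t hs ht,
          fun h => (hp.2 s t h).elim hsp htp, ?_⟩, le_sup_left, le_sup_right⟩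
        rw [Quantale.sup_mul_distrib]
        refine sup_le ?_ ?_
        · rw [← mul_assoc]; exact (mul_le_left _ _).trans hbs
        · rw [mul_left_comm]; exact (mul_le_right _ _).trans hct) h
  exact ⟨s, hs, hsp, (mul_mono hab le_rfl).trans hbs⟩

theorem le_localize (hp : IsPrime p) (x : L) : x ≤ localize p x :=
  le_localize_of_mul_le (fun h => hp.1 (top_le_iff.1 h)) (mul_le_left x ⊤)

theorem localize_localize (hp : IsPrime p) (x : L) :
    localize p (localize p x) = localize p x := by
  refine le_antisymm (sSup_le ?_) (le_localize hp _)
  rintro a ⟨ha, s, hs, hsp, has⟩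
  obtain ⟨t, ht, htp, h⟩ := (le_localize_iff hp (IsCLattice.isCompact_mul a s ha hs)).1 has
  refine le_localize_of_mul_le (s := s * t) (fun h => (hp.2 s t h).elim hsp htp) ?_
  rwa [← mul_assoc]

theorem localize_mul_le (p x y : L) : localize p x * y ≤ localize p (x * y) := by
  conv_lhs => rw [localize, IsQuantale.sSup_mul_distrib]
  refine iSup₂_le ?_
  rintro a ⟨ha, s, hs, hsp, has⟩
  refine le_localize_of_mul_le hsp ?_
  rw [mul_right_comm]
  exact mul_mono has le_rfl

theorem localize_localize_mul (hp : IsPrime p) (x y : L) :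
    localize p (localize p x * y) = localize p (x * y) := by
  refine le_antisymm ?_ (localize_mono p (mul_mono (le_localize hp x) le_rfl))
  rw [← localize_localize hp (x * y)]
  exact localize_mono p (localize_mul_le p x y)

theorem localize_mul_localize (hp : IsPrime p) (x y : L) :
    localize p (x * localize p y) = localize p (x * y) := by
  rw [mul_comm, localize_localize_mul hp, mul_comm]

theorem localize_inf (hp : IsPrime p) (x y : L) :
    localize p (x ⊓ y) = localize p x ⊓ localize p y := by
  refine le_antisymm (le_inf (localize_mono p inf_le_left) (localize_mono p inf_le_right)) ?_
  rw [le_iff_compact_le_imp]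
  intro a ha h
  obtain ⟨s, -, hsp, has⟩ := (le_localize_iff hp ha).1 (h.trans inf_le_left)
  obtain ⟨t, -, htp, hat⟩ := (le_localize_iff hp ha).1 (h.trans inf_le_right)
  refine le_localize_of_mul_le (s := s * t) (fun h => (hp.2 s t h).elim hsp htp) (le_inf ?_ ?_)
  · rw [← mul_assoc]; exact (mul_le_left _ _).trans has
  · rw [mul_left_comm]; exact (mul_le_right _ _).trans hat

theorem localize_eq_top {x : L} (h : ¬ x ≤ p) : localize p x = ⊤ :=
  top_le_iff.1 (le_localize_of_mul_le h (mul_le_right _ _))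

theorem localize_residual (hp : IsPrime p) {x : L} (hx : IsCompactElement x) (w : L) :
    localize p (residual w x) = residual (localize p w) x := by
  apply le_antisymm
  · refine sSup_le ?_
    rintro a ⟨-, s, -, hsp, has⟩
    rw [le_residual_iff] at has ⊢
    exact le_localize_of_mul_le hsp (by rwa [mul_right_comm])
  · rw [le_iff_compact_le_imp]
    intro a ha h
    rw [le_residual_iff, le_localize_iff hp (IsCLattice.isCompact_mul a x ha hx)] at h
    obtain ⟨s, -, hsp, has⟩ := h
    refine le_localize_of_mul_le hsp ?_
    rwa [le_residual_iff, mul_right_comm]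

/-- For compact `a ≤ x`, if `(y : a)` were proper it would lie below some maximal `m`; but `a ≤
localize m y` supplies an element of `(y : a)` outside `m`. -/
theorem le_of_forall_localize_le {x y : L}
    (h : ∀ m, IsCoatom m → localize m x ≤ localize m y) : x ≤ y := by
  rw [le_iff_compact_le_imp]
  intro a ha hax
  rw [← residual_eq_top_iff]
  by_contra hne
  have := CompleteLattice.coatomic_of_top_compact (IsCLattice.isCompact_top (L := L))
  obtain ⟨m, hm, hle⟩ := (IsCoatomic.eq_top_or_exists_le_coatom _).resolve_left hne
  have hp := isPrime_of_isCoatom hm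
  obtain ⟨s, -, hsm, has⟩ := (le_localize_iff hp ha).1
    ((hax.trans (le_localize hp x)).trans (h m hm))
  exact hsm ((le_residual_iff.2 (by rwa [mul_comm])).trans hle)

end Localize

/-! ### The localized lattice inherits the hypotheses. -/

section LocalizedLattice

variable {L : Type*} [CompleteLattice L] [CommMonoid L] [IsCLattice L] {p : L}

/-- The image of `x` in the localization at `p`. -/
def toLocalized (p x : L) : LocalizedLattice p := ⟨localize p x, x, rfl⟩

theorem LocalizedLattice.localize_val (hp : IsPrime p) (x : LocalizedLattice p) :
    localize p x.1 = x.1 := by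
  obtain ⟨_, x, rfl⟩ := x
  exact localize_localize hp x

theorem localize_le_iff (hp : IsPrime p) {x : L} {y : LocalizedLattice p} :
    localize p x ≤ y.1 ↔ x ≤ y.1 :=
  ⟨(le_localize hp x).trans, fun h => by rw [← y.localize_val hp]; exact localize_mono p h⟩

theorem toLocalized_val (hp : IsPrime p) (x : LocalizedLattice p) : toLocalized p x.1 = x :=
  Subtype.ext (x.localize_val hp)

/-- Localization is a Galois insertion onto the localized lattice. -/
def localizedGaloisInsertion (hp : IsPrime p) :
    GaloisInsertion (toLocalized p) (Subtype.val : LocalizedLattice p → L) where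
  choice x _ := toLocalized p x
  gc _ _ := localize_le_iff hp
  le_l_u x := le_localize hp x.1
  choice_eq _ _ := rfl

instance [hp : Fact (IsPrime p)] : CompleteLattice (LocalizedLattice p) :=
  (localizedGaloisInsertion hp.out).liftCompleteLattice

instance [hp : Fact (IsPrime p)] : CommMonoid (LocalizedLattice p) where
  one := toLocalized p 1
  mul_assoc x y z := Subtype.ext (by
    change localize p (localize p (x.1 * y.1) * z.1) = localize p (x.1 * localize p (y.1 * z.1))
    rw [localize_localize_mul hp.out, localize_mul_localize hp.out, mul_assoc])
  mul_comm x y := Subtype.ext (congrArg (localize p) (mul_comm x.1 y.1))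
  one_mul x := Subtype.ext (by
    change localize p (localize p 1 * x.1) = x.1
    rw [localize_localize_mul hp.out, one_mul, x.localize_val hp.out])
  mul_one x := Subtype.ext (by
    change localize p (x.1 * localize p 1) = x.1
    rw [localize_mul_localize hp.out, mul_one, x.localize_val hp.out])

variable [hp : Fact (IsPrime p)]

theorem LocalizedLattice.val_inf (x y : LocalizedLattice p) : (x ⊓ y).1 = x.1 ⊓ y.1 :=
  (localizedGaloisInsertion hp.out).gc.u_inf

theorem LocalizedLattice.val_sup (x y : LocalizedLattice p) :
    (x ⊔ y).1 = localize p (x.1 ⊔ y.1) := rfl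

theorem LocalizedLattice.val_top : (⊤ : LocalizedLattice p).1 = ⊤ :=
  (localizedGaloisInsertion hp.out).gc.u_top

theorem toLocalized_mul (x y : L) :
    toLocalized p (x * y) = toLocalized p x * toLocalized p y := Subtype.ext (by
  change localize p (x * y) = localize p (localize p x * localize p y)
  rw [localize_localize_mul hp.out, localize_mul_localize hp.out])

theorem toLocalized_sSup (S : Set L) :
    toLocalized p (sSup S) = ⨆ x ∈ S, toLocalized p x :=
  (localizedGaloisInsertion hp.out).gc.l_sSup

theorem toLocalized_bot : toLocalized p ⊥ = (⊥ : LocalizedLattice p) :=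
  (localizedGaloisInsertion hp.out).gc.l_bot

theorem LocalizedLattice.mul_sSup (x : LocalizedLattice p) (S : Set (LocalizedLattice p)) :
    x * sSup S = ⨆ y ∈ S, x * y := by
  have h1 : sSup S = toLocalized p (sSup ((fun y : LocalizedLattice p => y.1) '' S)) := rfl
  rw [h1]
  conv_lhs => rw [← toLocalized_val hp.out x, ← toLocalized_mul, IsQuantale.mul_sSup_distrib,
    (localizedGaloisInsertion hp.out).gc.l_iSup₂]
  rw [iSup_image]
  refine iSup_congr fun y => iSup_congr fun _ => ?_
  rw [toLocalized_mul, toLocalized_val hp.out, toLocalized_val hp.out]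

instance : IsMultiplicativeLattice (LocalizedLattice p) where
  mul_sSup_distrib := LocalizedLattice.mul_sSup
  sSup_mul_distrib S x := by
    rw [mul_comm, LocalizedLattice.mul_sSup]
    simp_rw [mul_comm]
  one_eq_top := top_le_iff.1 (by
    change (⊤ : LocalizedLattice p).1 ≤ localize p 1
    rw [LocalizedLattice.val_top, ← IsMultiplicativeLattice.one_eq_top]
    exact le_localize hp.out 1)

theorem LocalizedLattice.mul_le_iff (x y z : LocalizedLattice p) :
    x * y ≤ z ↔ x.1 * y.1 ≤ z.1 := localize_le_iff hp.out

/-- Residuals by compact elements commute with localization. Principal elements are compact, so this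
carries the principal identities over to the localized lattice. -/
theorem LocalizedLattice.val_residual (y : LocalizedLattice p) {x : L} (hx : IsCompactElement x) :
    (residual y (toLocalized p x)).1 = residual y.1 x := by
  have h1 : localize p (residual y.1 x) = residual y.1 x := by
    rw [localize_residual hp.out hx, y.localize_val hp.out]
  have h2 : residual y (toLocalized p x) = toLocalized p (residual y.1 x) := by
    refine eq_of_forall_le_iff fun c => ?_
    have h3 : c ≤ toLocalized p (residual y.1 x) ↔ c.1 ≤ residual y.1 x := by
      conv_rhs => rw [← h1]
      rfl
    rw [h3, le_residual_iff, le_residual_iff]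
    change localize p (c.1 * localize p x) ≤ y.1 ↔ _
    rw [localize_mul_localize hp.out, localize_le_iff hp.out]
  rw [h2]
  exact h1

theorem IsPrincipal.toLocalized (hdom : IsLatticeDomain L) {x : L} (hx : IsPrincipal x) :
    IsPrincipal (toLocalized p x) := by
  have hc := hx.isCompactElement hdom
  refine ⟨fun y z => Subtype.ext ?_, fun y z => Subtype.ext ?_⟩
  · rw [LocalizedLattice.val_inf, LocalizedLattice.val_mul, LocalizedLattice.val_mul,
      LocalizedLattice.val_inf, LocalizedLattice.val_residual y hc]
    change y.1 ⊓ localize p (z.1 * localize p x) = localize p ((_ ⊓ _) * localize p x)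
    rw [localize_mul_localize hp.out, localize_mul_localize hp.out, ← hx.1, localize_inf hp.out,
      y.localize_val hp.out]
  · rw [LocalizedLattice.val_residual _ hc, LocalizedLattice.val_sup, LocalizedLattice.val_sup,
      LocalizedLattice.val_residual z hc, LocalizedLattice.val_mul, hx.2,
      localize_residual hp.out hc]
    change residual (localize p (y.1 * x ⊔ z.1)) x =
      residual (localize p (localize p (y.1 * localize p x) ⊔ z.1)) x
    rw [localize_mul_localize hp.out]
    congr 1
    refine le_antisymm (localize_mono p (sup_le_sup (le_localize hp.out _) le_rfl)) ?_
    rw [← localize_localize hp.out (y.1 * x ⊔ z.1)]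
    exact localize_mono p (sup_le (localize_mono p le_sup_left)
      (le_sup_right.trans (le_localize hp.out _)))

theorem isPrincipallyGenerated_localizedLattice (hdom : IsLatticeDomain L)
    (hgen : IsPrincipallyGenerated L) : IsPrincipallyGenerated (LocalizedLattice p) := by
  intro a
  obtain ⟨S, hS, hSa⟩ := hgen a.1
  refine ⟨toLocalized p '' S, ?_, ?_⟩
  · rintro _ ⟨x, hx, rfl⟩
    exact (hS x hx).toLocalized hdom
  · rw [sSup_image, ← toLocalized_sSup, hSa, toLocalized_val hp.out]

theorem LocalizedLattice.val_bot (hdom : IsLatticeDomain L) :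
    (⊥ : LocalizedLattice p).1 = ⊥ := by
  rw [← toLocalized_bot]
  exact localize_bot hdom p

theorem isLatticeDomain_localizedLattice (hdom : IsLatticeDomain L) :
    IsLatticeDomain (LocalizedLattice p) := by
  refine ⟨fun h => hdom.1 ?_, fun x y h => ?_⟩
  · rw [← LocalizedLattice.val_bot (p := p) hdom, h, LocalizedLattice.val_top]
  · rw [LocalizedLattice.mul_le_iff, LocalizedLattice.val_bot hdom] at h
    refine (hdom.2 _ _ h).imp (fun h => ?_) (fun h => ?_)
    · exact le_trans (b := x.1) le_rfl (h.trans bot_le)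
    · exact le_trans (b := y.1) le_rfl (h.trans bot_le)

theorem isSharp_localizedLattice (hsharp : IsSharp L) : IsSharp (LocalizedLattice p) := by
  intro a b c h
  rw [LocalizedLattice.mul_le_iff] at h
  obtain ⟨b₁, b₂, hb, h1, h2⟩ := hsharp _ _ _ h
  refine ⟨toLocalized p b₁, toLocalized p b₂, ?_, h1.trans (le_localize hp.out _),
    h2.trans (le_localize hp.out _)⟩
  rw [← toLocalized_mul, ← hb, toLocalized_val hp.out]

theorem localizedLattice_classification_of_isSharp (hdom : IsLatticeDomain L)
    (hgen : IsPrincipallyGenerated L) (hne : ∃ x : L, x ≠ ⊥ ∧ x ≠ ⊤) (hsharp : IsSharp L) {m : L}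
    (hm : IsCoatom m) : Nonempty (LocalizedLattice m ≃*o ZMinus) ∨
      Nonempty (LocalizedLattice m ≃*o ROne) := by
  have hpm : Fact (IsPrime m) := ⟨isPrime_of_isCoatom hm⟩
  have hmm : localize m m = m :=
    le_antisymm (localize_le_of_le hpm.out le_rfl) (le_localize hpm.out m)
  refine isSharp_local_classification (m := toLocalized m m)
    (isLatticeDomain_localizedLattice hdom) (isPrincipallyGenerated_localizedLattice hdom hgen)
    (isSharp_localizedLattice hsharp) (fun h => ?_) (fun h => ?_) fun x hx => ?_
  · have := congrArg Subtype.val h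
    rw [LocalizedLattice.val_top] at this
    exact hm.1 (hmm.symm.trans this)
  · have := congrArg Subtype.val h
    rw [LocalizedLattice.val_bot hdom] at this
    obtain ⟨x, hx0, hx1⟩ := hne
    -- If `m = ⊥`, maximality would make every nonzero element equal to `⊤`, against `hne`.
    exact hx1 (hm.2 x ((hmm.symm.trans this).symm ▸ bot_lt_iff_ne_bot.2 hx0))
  · change x.1 ≤ localize m m
    rw [hmm]
    by_contra h
    refine hx (Subtype.ext ?_)
    rw [LocalizedLattice.val_top, ← x.localize_val hpm.out, localize_eq_top h]

end LocalizedLattice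

/-! ### Sharpness and Archimedean powers in the two models. -/

section ModelProperties

/-- The sharp property of an ordered set with multiplication. -/
def SharpFactorization (X : Type*) [PartialOrder X] [Mul X] : Prop :=
  ∀ a b c : X, a * b ≤ c → ∃ c₁ c₂ : X, c = c₁ * c₂ ∧ a ≤ c₁ ∧ b ≤ c₂

/-- The powers of every element that is neither greatest nor idempotent eventually lie below any
given element that is not least. -/
def ArchimedeanPowers (X : Type*) [PartialOrder X] [Mul X] : Prop :=
  ∀ x c : X, (∃ y, ¬ y ≤ x) → x * x ≠ x → (∃ y, ¬ c ≤ y) →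
    ∀ u : ℕ → X, u 0 = x → (∀ n, u (n + 1) = u n * x) → ∃ n, u n ≤ c

theorem SharpFactorization.of_mulOrderIso {X Y : Type*} [PartialOrder X] [Mul X] [PartialOrder Y]
    [Mul Y] (e : Y ≃*o X) (h : SharpFactorization X) : SharpFactorization Y := by
  intro a b c habc
  obtain ⟨c₁, c₂, hc, h1, h2⟩ := h (e a) (e b) (e c) (by
    rw [← map_mul]
    exact (map_le_map_iff e).2 habc)
  refine ⟨e.symm c₁, e.symm c₂, ?_, ?_, ?_⟩
  · rw [← map_mul, ← hc]
    exact (e.toEquiv.symm_apply_apply c).symm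
  · exact e.toOrderIso.le_symm_apply.2 h1
  · exact e.toOrderIso.le_symm_apply.2 h2

/-- The property speaks only of order and product, with `u n` in the role of `x ^ (n + 1)`, so no
unit has to be transported. -/
theorem ArchimedeanPowers.of_mulOrderIso {X Y : Type*} [PartialOrder X] [Mul X] [PartialOrder Y]
    [Mul Y] (e : Y ≃*o X) (h : ArchimedeanPowers X) : ArchimedeanPowers Y := by
  rintro x c ⟨y, hy⟩ hx ⟨z, hz⟩ u hu0 hu
  obtain ⟨n, hn⟩ := h (e x) (e c) ⟨e y, fun h => hy ((map_le_map_iff e).1 h)⟩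
    (fun h => hx (e.toEquiv.injective (by rw [← map_mul] at h; exact h)))
    ⟨e z, fun h => hz ((map_le_map_iff e).1 h)⟩ (fun n => e (u n)) (by simp only [hu0])
    (fun n => by simp only [hu n, map_mul])
  exact ⟨n, (map_le_map_iff e).1 hn⟩

theorem ZMinus.upper_injective : Function.Injective ZMinus.upper := fun x y h =>
  le_antisymm ((ZMinus.le_iff x y).2 h.le) ((ZMinus.le_iff y x).2 h.ge)

/-- The element `-n` of `ℤ₋`. -/
def ZMinus.neg (n : ℕ) : ZMinus :=
  ⟨((-(n : ℤ) : ℤ) : WithBot ℤ), show _ ≤ ((0 : ℤ) : WithBot ℤ) from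
    WithBot.coe_le_coe.2 (by omega)⟩

theorem ZMinus.upper_neg (n : ℕ) : (ZMinus.neg n).upper = Set.Ici n := ZMinus.upper_of_eq rfl

theorem ZMinus.upper_eq_empty_or (x : ZMinus) : x.upper = ∅ ∨ ∃ n, x = ZMinus.neg n := by
  rcases x.eq_bot_or with h | ⟨n, h⟩
  · exact Or.inl (ZMinus.upper_of_eq_bot h)
  · exact Or.inr ⟨n, Subtype.ext h⟩

theorem ZMinus.neg_mul_neg (n k : ℕ) : neg n * neg k = neg (n + k) := by
  apply upper_injective
  rw [upper_mul, upper_neg, upper_neg, upper_neg]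
  ext u
  simp only [Set.mem_Ici, Set.mem_add]
  exact ⟨by rintro ⟨a, ha, b, hb, rfl⟩; omega, fun h => ⟨n, le_rfl, u - n, by omega, by omega⟩⟩

theorem ZMinus.neg_le_neg (n k : ℕ) : neg n ≤ neg k ↔ k ≤ n := by
  rw [le_iff, upper_neg, upper_neg, Set.Ici_subset_Ici]

theorem ZMinus.le_neg_zero (x : ZMinus) : x ≤ neg 0 := by
  rw [le_iff, upper_neg]
  exact fun n _ => Nat.zero_le n

theorem ZMinus.mul_neg_zero (x : ZMinus) : x * neg 0 = x := by
  rcases x.upper_eq_empty_or with h | ⟨n, rfl⟩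
  · apply upper_injective
    rw [upper_mul, h, Set.empty_add]
  · rw [neg_mul_neg, add_zero]

theorem ZMinus.neg_zero_mul (x : ZMinus) : neg 0 * x = x := by
  rcases x.upper_eq_empty_or with h | ⟨n, rfl⟩
  · apply upper_injective
    rw [upper_mul, h, Set.add_empty]
  · rw [neg_mul_neg, zero_add]

theorem ZMinus.sharpFactorization : SharpFactorization ZMinus := by
  intro a b c h
  by_cases hac : a ≤ c
  · exact ⟨c, neg 0, (mul_neg_zero c).symm, hac, le_neg_zero b⟩
  by_cases hbc : b ≤ c
  · exact ⟨neg 0, c, (neg_zero_mul c).symm, le_neg_zero a, hbc⟩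
  rcases a.upper_eq_empty_or with ha | ⟨n, rfl⟩
  · exact absurd ((le_iff a c).2 (ha ▸ Set.empty_subset _)) hac
  rcases b.upper_eq_empty_or with hb | ⟨k, rfl⟩
  · exact absurd ((le_iff b c).2 (hb ▸ Set.empty_subset _)) hbc
  rcases c.upper_eq_empty_or with hc | ⟨u, rfl⟩
  · rw [neg_mul_neg, le_iff, upper_neg, hc] at h
    exact (h (Set.mem_Ici.2 le_rfl)).elim
  · rw [neg_mul_neg, neg_le_neg] at h
    rw [neg_le_neg] at hac
    refine ⟨neg n, neg (u - n), ?_, le_rfl, ?_⟩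
    · rw [neg_mul_neg]
      congr 1
      omega
    · rw [neg_le_neg]
      omega

theorem ZMinus.archimedeanPowers : ArchimedeanPowers ZMinus := by
  rintro x c ⟨y, hy⟩ hx ⟨z, hz⟩ u hu0 hu
  rcases x.upper_eq_empty_or with h | ⟨n, rfl⟩
  · exact absurd (upper_injective (by rw [upper_mul, h, Set.empty_add])) hx
  rcases c.upper_eq_empty_or with hc | ⟨w, rfl⟩
  · exact absurd ((le_iff c z).2 (hc ▸ Set.empty_subset _)) hz
  have hn : n ≠ 0 := by
    rintro rfl
    exact hy (le_neg_zero y)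
  have huk : ∀ k, u k = neg ((k + 1) * n) := fun k => by
    induction k with
    | zero => rw [hu0, zero_add, one_mul]
    | succ k ih => rw [hu, ih, neg_mul_neg]; congr 1; ring
  refine ⟨w, ?_⟩
  rw [huk, neg_le_neg]
  have := Nat.le_mul_of_pos_right (w + 1) (Nat.pos_of_ne_zero hn)
  omega

theorem ROne.upper_injective : Function.Injective ROne.upper := fun x y h =>
  le_antisymm ((ROne.le_iff x y).2 h.le) ((ROne.le_iff y x).2 h.ge)

/-- The interval `[r, ∞]`. -/
def ROne.ici (r : ℝ≥0) : ROne := ⟨Set.Icc r ⊤, Or.inl ⟨r, rfl⟩⟩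

/-- The interval `(r, ∞]`. -/
def ROne.ioi (r : ℝ≥0) : ROne := ⟨Set.Ioc r ⊤, Or.inr (Or.inl ⟨r, rfl⟩)⟩

theorem ROne.upper_ici (r : ℝ≥0) : (ici r).upper = Set.Ici r := by
  ext u
  simp [upper, ici]

theorem ROne.upper_ioi (r : ℝ≥0) : (ioi r).upper = Set.Ioi r := by
  ext u
  simp [upper, ioi]

theorem ROne.upper_eq_empty_or (x : ROne) :
    x.upper = ∅ ∨ (∃ r, x = ici r) ∨ ∃ r, x = ioi r := by
  rcases x.2 with ⟨r, h⟩ | ⟨r, h⟩ | h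
  · exact Or.inr (Or.inl ⟨r, Subtype.ext h⟩)
  · exact Or.inr (Or.inr ⟨r, Subtype.ext h⟩)
  · left
    ext u
    simp [upper, h]

theorem ROne.mul_comm (x y : ROne) : x * y = y * x := Subtype.ext (add_comm x.1 y.1)

theorem ROne.ici_mul_ici (r t : ℝ≥0) : ici r * ici t = ici (r + t) :=
  Subtype.ext (Icc_add_Icc_top r t)

theorem ROne.ioi_mul_ici (r t : ℝ≥0) : ioi r * ici t = ioi (r + t) :=
  Subtype.ext (Ioc_add_Icc_top r t)

theorem ROne.ici_mul_ioi (r t : ℝ≥0) : ici r * ioi t = ioi (r + t) := by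
  rw [mul_comm, ioi_mul_ici, add_comm]

theorem ROne.ioi_mul_ioi (r t : ℝ≥0) : ioi r * ioi t = ioi (r + t) :=
  Subtype.ext (Ioc_add_Ioc_top r t)

theorem ROne.ici_le_ici (r t : ℝ≥0) : ici r ≤ ici t ↔ t ≤ r := by
  rw [le_iff, upper_ici, upper_ici, Set.Ici_subset_Ici]

theorem ROne.ioi_le_ici (r t : ℝ≥0) : ioi r ≤ ici t ↔ t ≤ r := by
  rw [le_iff, upper_ici, upper_ioi]
  exact ⟨fun h => le_of_forall_gt_imp_ge_of_dense fun a ha => h ha,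
    fun h a ha => h.trans (le_of_lt ha)⟩

theorem ROne.ioi_le_ioi (r t : ℝ≥0) : ioi r ≤ ioi t ↔ t ≤ r := by
  rw [le_iff, upper_ioi, upper_ioi, Set.Ioi_subset_Ioi_iff]

theorem ROne.ici_le_ioi (r t : ℝ≥0) : ici r ≤ ioi t ↔ t < r := by
  rw [le_iff, upper_ici, upper_ioi, Set.Ici_subset_Ioi]

theorem ROne.le_ici_zero (x : ROne) : x ≤ ici 0 := by
  rw [le_iff, upper_ici]
  exact fun n _ => Set.mem_Ici.2 zero_le

theorem ROne.mul_ici_zero (x : ROne) : x * ici 0 = x := by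
  rcases x.upper_eq_empty_or with h | ⟨n, rfl⟩ | ⟨n, rfl⟩
  · apply upper_injective
    rw [upper_mul, h, Set.empty_add]
  · rw [ici_mul_ici, add_zero]
  · rw [ioi_mul_ici, add_zero]

theorem ROne.sharpFactorization : SharpFactorization ROne := by
  intro a b c h
  by_cases hac : a ≤ c
  · exact ⟨c, ici 0, (mul_ici_zero c).symm, hac, le_ici_zero b⟩
  by_cases hbc : b ≤ c
  · exact ⟨ici 0, c, by rw [mul_comm, mul_ici_zero], le_ici_zero a, hbc⟩
  rcases c.upper_eq_empty_or with hc | ⟨u, rfl⟩ | ⟨u, rfl⟩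
  · rcases a.upper_eq_empty_or with ha | ⟨r, rfl⟩ | ⟨r, rfl⟩
    · exact absurd ((le_iff a c).2 (ha ▸ Set.empty_subset _)) hac
    all_goals
      rcases b.upper_eq_empty_or with hb | ⟨t, rfl⟩ | ⟨t, rfl⟩
      · exact absurd ((le_iff b c).2 (hb ▸ Set.empty_subset _)) hbc
      all_goals
        rw [le_iff, hc, Set.subset_empty_iff] at h
        simp only [ici_mul_ici, ici_mul_ioi, ioi_mul_ici, ioi_mul_ioi, upper_ici, upper_ioi] at h
        first
        | exact absurd h Set.nonempty_Ici.ne_empty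
        | exact absurd h Set.nonempty_Ioi.ne_empty
  -- For a closed target, open endpoints of `a` and `b` may be closed up: the sum of the endpoints
  -- is still at least `u`.
  · obtain ⟨r, har, hru, hr⟩ : ∃ r, a ≤ ici r ∧ r ≤ u ∧ b ≤ ici (u - r) := by
      rcases a.upper_eq_empty_or with ha | ⟨r, rfl⟩ | ⟨r, rfl⟩
      · exact absurd ((le_iff a _).2 (ha ▸ Set.empty_subset _)) hac
      all_goals
        refine ⟨r, by first | exact le_rfl | exact (ioi_le_ici r r).2 le_rfl, ?_, ?_⟩
        · simp only [ici_le_ici, ioi_le_ici] at hac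
          exact (not_le.1 hac).le
        rcases b.upper_eq_empty_or with hb | ⟨t, rfl⟩ | ⟨t, rfl⟩
        · exact absurd ((le_iff b _).2 (hb ▸ Set.empty_subset _)) hbc
        all_goals
          simp only [ici_mul_ici, ici_mul_ioi, ioi_mul_ici, ioi_mul_ioi, ici_le_ici,
            ioi_le_ici] at h ⊢
          exact tsub_le_iff_left.2 h
    exact ⟨ici r, ici (u - r), by rw [ici_mul_ici, add_tsub_cancel_of_le hru], har, hr⟩
  -- For an open target exactly one factor is taken open: the second if `a` is closed, the first if
  -- `a` is open.
  · rcases a.upper_eq_empty_or with ha | ⟨r, rfl⟩ | ⟨r, rfl⟩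
    · exact absurd ((le_iff a _).2 (ha ▸ Set.empty_subset _)) hac
    · rw [ici_le_ioi, not_lt] at hac
      refine ⟨ici r, ioi (u - r), by rw [ici_mul_ioi, add_tsub_cancel_of_le hac], le_rfl, ?_⟩
      rcases b.upper_eq_empty_or with hb | ⟨t, rfl⟩ | ⟨t, rfl⟩
      · exact absurd ((le_iff b _).2 (hb ▸ Set.empty_subset _)) hbc
      · rw [ici_mul_ici, ici_le_ioi] at h
        rw [ici_le_ioi]
        exact (tsub_lt_iff_left hac).2 h
      · rw [ici_mul_ioi, ioi_le_ioi] at h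
        rw [ioi_le_ioi]
        exact tsub_le_iff_left.2 h
    · rw [ioi_le_ioi, not_le] at hac
      refine ⟨ioi r, ici (u - r), by rw [ioi_mul_ici, add_tsub_cancel_of_le hac.le], le_rfl, ?_⟩
      rcases b.upper_eq_empty_or with hb | ⟨t, rfl⟩ | ⟨t, rfl⟩
      · exact absurd ((le_iff b _).2 (hb ▸ Set.empty_subset _)) hbc
      all_goals
        simp only [ioi_mul_ici, ioi_mul_ioi, ioi_le_ioi, ici_le_ici, ioi_le_ici] at h ⊢
        exact tsub_le_iff_left.2 h

theorem ROne.archimedeanPowers : ArchimedeanPowers ROne := by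
  rintro x c ⟨y, hy⟩ hx ⟨z, hz⟩ u hu0 hu
  obtain ⟨w, hw⟩ : ∃ w, ici w ≤ c := by
    rcases c.upper_eq_empty_or with hc | ⟨w, rfl⟩ | ⟨w, rfl⟩
    · exact absurd ((le_iff c z).2 (hc ▸ Set.empty_subset _)) hz
    · exact ⟨w, le_rfl⟩
    · exact ⟨w + 1, (ici_le_ioi _ _).2 (lt_add_one w)⟩
  obtain ⟨r, hr, hur⟩ : ∃ r : ℝ≥0, 0 < r ∧ ∀ k, u k ≤ ici ((k + 1) * r) := by
    rcases x.upper_eq_empty_or with h | ⟨r, rfl⟩ | ⟨r, rfl⟩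
    · exact absurd (upper_injective (by rw [upper_mul, h, Set.empty_add])) hx
    · refine ⟨r, pos_iff_ne_zero.2 ?_, fun k => ?_⟩
      · rintro rfl
        exact hy (le_ici_zero y)
      · refine le_of_eq ?_
        induction k with
        | zero => simp [hu0]
        | succ k ih => rw [hu, ih, ici_mul_ici]; congr 1; push_cast; ring
    · refine ⟨r, pos_iff_ne_zero.2 ?_, fun k => ?_⟩
      · rintro rfl
        -- The interval `(0, ∞]` is idempotent; this is the case that the non-idempotence hypothesis
        -- excludes.
        exact hx (by rw [ioi_mul_ioi, add_zero])
      · have huk : u k = ioi ((k + 1) * r) := by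
          induction k with
          | zero => simp [hu0]
          | succ k ih => rw [hu, ih, ioi_mul_ioi]; congr 1; push_cast; ring
        rw [huk, ioi_le_ici]
  obtain ⟨k, hk⟩ := exists_nat_gt (w / r)
  refine ⟨k, (hur k).trans (le_trans ((ici_le_ici _ _).2 ?_) hw)⟩
  rw [div_lt_iff₀ hr] at hk
  refine hk.le.trans ?_
  gcongr
  exact le_self_add

end ModelProperties

/-! ### Gluing local factorizations. -/

section Globalization

theorem IsPrime.le_of_pow_le {L : Type*} [CompleteLattice L] [CommMonoid L] {p s : L} (hp : IsPrime p) {n : ℕ}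
    (h : s ^ (n + 1) ≤ p) : s ≤ p := by
  induction n with
  | zero => simpa using h
  | succ k ih =>
    rw [pow_succ] at h
    exact (hp.2 _ _ h).elim ih id

variable {L : Type*} [CompleteLattice L] [CommMonoid L] [IsCLattice L]

/-- Choose a principal `s` below `m` but not below `n`. In the localization at `m` some power of `s`
falls below `c`, so `c ≤ n` would force `s ≤ n` by primality. -/
theorem not_le_of_archimedeanPowers (hdom : IsLatticeDomain L) (hgen : IsPrincipallyGenerated L)
    {m n c : L} (hm : IsCoatom m) (hn : IsCoatom n) (hmn : m ≠ n)
    (harch : ArchimedeanPowers (LocalizedLattice m)) (hc : localize m c = c) (hc0 : c ≠ ⊥) :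
    ¬ c ≤ n := by
  have hp := isPrime_of_isCoatom hm
  have hmn' : ¬ m ≤ n := fun h => (hm.le_iff.1 h).elim hn.1 fun h => hmn h.symm
  obtain ⟨s, hs, hsm, hsn⟩ : ∃ s, IsPrincipal s ∧ s ≤ m ∧ ¬ s ≤ n := by
    obtain ⟨S, hS, rfl⟩ := hgen m
    by_contra! h
    exact hmn' (sSup_le fun s hs => h s (hS s hs) (le_sSup hs))
  have hs0 : s ≠ ⊥ := by
    rintro rfl
    exact hsn bot_le
  have hfact : Fact (IsPrime m) := ⟨hp⟩
  obtain ⟨k, hk⟩ := harch (toLocalized m s) (toLocalized m c)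
    ⟨toLocalized m ⊤, fun h => hm.1 (top_le_iff.1
      ((le_localize hp ⊤).trans (le_trans h (localize_le_of_le hp hsm))))⟩
    -- If `s` were idempotent locally, then `t * s ≤ s * s` for some `t` outside `m`, and cancelling
    -- `s` gives `t ≤ s ≤ m`.
    (fun h => by
      rw [← toLocalized_mul] at h
      have h1 : localize m (s * s) = localize m s := congrArg Subtype.val h
      obtain ⟨t, -, htm, hst⟩ := (le_localize_iff hp (hs.isCompactElement hdom)).1
        ((le_localize hp s).trans h1.ge)
      rw [mul_comm] at hst
      exact htm ((hs.le_of_mul_le_mul hdom hs0 hst).trans hsm))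
    ⟨toLocalized m ⊥, fun h => hc0 (le_bot_iff.1 ((le_localize hp c).trans
      (le_trans h (localize_bot hdom m).le)))⟩
    (fun k => toLocalized m (s ^ (k + 1))) (by simp only [zero_add, pow_one])
    (fun k => by rw [← toLocalized_mul, ← pow_succ])
  refine fun hcn => hsn ((isPrime_of_isCoatom hn).le_of_pow_le (n := k) ?_)
  exact ((le_localize hp _).trans hk).trans (hc.le.trans hcn)

theorem localize_finset_inf {p : L} (hp : IsPrime p) {ι : Type*} (F : Finset ι) (f : ι → L) :
    localize p (F.inf f) = F.inf fun i => localize p (f i) := by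
  classical
  induction F using Finset.induction_on with
  | empty => exact localize_eq_top fun h => hp.1 (top_le_iff.1 h)
  | insert i F _ ih => rw [Finset.inf_insert, localize_inf hp, ih, Finset.inf_insert]

/-- Localization commutes with finite meets, and at `n` every component attached to another maximal
element becomes `⊤`. -/
theorem localize_finset_inf_coatoms {F : Finset L} {f : L → L}
    (hf : ∀ m ∈ F, localize m (f m) = f m)
    (hfn : ∀ m ∈ F, ∀ n, IsCoatom n → m ≠ n → ¬ f m ≤ n) {n : L} (hn : IsCoatom n) :
    (n ∈ F → localize n (F.inf f) = f n) ∧ (n ∉ F → localize n (F.inf f) = ⊤) := by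
  rw [localize_finset_inf (isPrime_of_isCoatom hn)]
  refine ⟨fun hnF => le_antisymm ((Finset.inf_le hnF).trans (hf n hnF).le)
    (Finset.le_inf fun m hm => ?_), fun hnF => top_le_iff.1 (Finset.le_inf fun m hm => ?_)⟩
  · rcases eq_or_ne m n with rfl | hmn
    · exact (hf m hm).ge
    · rw [localize_eq_top (hfn m hm n hn hmn)]
      exact le_top
  · rw [localize_eq_top (hfn m hm n hn fun h => hnF (h ▸ hm))]

theorem isSharp_of_localizedLattice (hdom : IsLatticeDomain L) (hgen : IsPrincipallyGenerated L)
    (hfin : HasFiniteCharacter L)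
    (hsharp : ∀ m : L, IsCoatom m → SharpFactorization (LocalizedLattice m))
    (harch : ∀ m : L, IsCoatom m → ArchimedeanPowers (LocalizedLattice m)) : IsSharp L := by
  intro a₁ a₂ b hab
  -- Finite character says nothing about `⊥`, so this case is settled by primality of `⊥`.
  rcases eq_or_ne b ⊥ with rfl | hb0
  · rcases hdom.2 _ _ hab with h | h
    · exact ⟨⊥, ⊤, Quantale.bot_mul.symm, h, le_top⟩
    · exact ⟨⊤, ⊥, Quantale.mul_bot.symm, le_top, h⟩
  have hex : ∀ m : L, ∃ c₁ c₂ : L, IsCoatom m → localize m b = localize m (c₁ * c₂) ∧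
      a₁ ≤ c₁ ∧ a₂ ≤ c₂ ∧ localize m c₁ = c₁ ∧ localize m c₂ = c₂ := by
    intro m
    by_cases hm : IsCoatom m
    · have hp := isPrime_of_isCoatom hm
      have hfact : Fact (IsPrime m) := ⟨hp⟩
      obtain ⟨c₁, c₂, hc, h1, h2⟩ := hsharp m hm (toLocalized m a₁) (toLocalized m a₂)
        (toLocalized m b) (by rw [← toLocalized_mul]; exact localize_mono m hab)
      exact ⟨c₁.1, c₂.1, fun _ => ⟨congrArg Subtype.val hc, (le_localize hp _).trans h1,
        (le_localize hp _).trans h2, c₁.localize_val hp, c₂.localize_val hp⟩⟩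
    · exact ⟨⊥, ⊥, fun h => absurd h hm⟩
  choose c₁ c₂ hc using hex
  have hF : ∀ m ∈ (hfin b hb0).toFinset, IsCoatom m := fun m hm =>
    ((hfin b hb0).mem_toFinset.1 hm).1
  have hbc : ∀ m, IsCoatom m → b ≤ c₁ m ∧ b ≤ c₂ m := fun m hm => by
    obtain ⟨h, -, -, h1, h2⟩ := hc m hm
    have hb := (le_localize (isPrime_of_isCoatom hm) b).trans h.le
    exact ⟨hb.trans ((localize_mono m (mul_le_left _ _)).trans h1.le),
      hb.trans ((localize_mono m (mul_le_right _ _)).trans h2.le)⟩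
  have hloc₁ := fun n hn => localize_finset_inf_coatoms (n := n) (f := c₁)
    (fun m hm => (hc m (hF m hm)).2.2.2.1) (fun m hm n hn hmn =>
      not_le_of_archimedeanPowers hdom hgen (hF m hm) hn hmn (harch m (hF m hm))
        (hc m (hF m hm)).2.2.2.1 fun h => hb0 (le_bot_iff.1 (h ▸ (hbc m (hF m hm)).1))) hn
  have hloc₂ := fun n hn => localize_finset_inf_coatoms (n := n) (f := c₂)
    (fun m hm => (hc m (hF m hm)).2.2.2.2) (fun m hm n hn hmn =>
      not_le_of_archimedeanPowers hdom hgen (hF m hm) hn hmn (harch m (hF m hm))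
        (hc m (hF m hm)).2.2.2.2 fun h => hb0 (le_bot_iff.1 (h ▸ (hbc m (hF m hm)).2))) hn
  -- At maximal elements above `b` both sides reduce to the chosen local factorization; at all
  -- others both are `⊤`.
  have key : ∀ n, IsCoatom n → localize n b =
      localize n ((hfin b hb0).toFinset.inf c₁ * (hfin b hb0).toFinset.inf c₂) := by
    intro n hn
    have hp := isPrime_of_isCoatom hn
    rw [← localize_localize_mul hp, ← localize_mul_localize hp]
    by_cases hbn : b ≤ n
    · have hnF : n ∈ (hfin b hb0).toFinset := (hfin b hb0).mem_toFinset.2 ⟨hn, hbn⟩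
      rw [(hloc₁ n hn).1 hnF, (hloc₂ n hn).1 hnF, (hc n hn).1]
    · have hnF : n ∉ (hfin b hb0).toFinset := fun h => hbn ((hfin b hb0).mem_toFinset.1 h).2
      rw [(hloc₁ n hn).2 hnF, (hloc₂ n hn).2 hnF, localize_eq_top hbn,
        ← IsMultiplicativeLattice.one_eq_top, one_mul, IsMultiplicativeLattice.one_eq_top,
        localize_eq_top fun h => hn.1 (top_le_iff.1 h)]
  exact ⟨_, _, le_antisymm (le_of_forall_localize_le fun n hn => (key n hn).le)
    (le_of_forall_localize_le fun n hn => (key n hn).ge),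
    Finset.le_inf fun m hm => (hc m (hF m hm)).2.1,
    Finset.le_inf fun m hm => (hc m (hF m hm)).2.2.1⟩

end Globalization

end MultLattice

theorem mainTheorem3 {L : Type*} [CompleteLattice L] [CommMonoid L] [MultLattice.IsCLattice L]
    (hdom : MultLattice.IsLatticeDomain L)
    (hgen : MultLattice.IsPrincipallyGenerated L)
    (hne : ∃ x : L, x ≠ ⊥ ∧ x ≠ ⊤)
    (hfin : MultLattice.HasFiniteCharacter L) :
    MultLattice.IsSharp L ↔
      ∀ m : L, IsCoatom m →
        Nonempty (MultLattice.LocalizedLattice m ≃*o MultLattice.ZMinus) ∨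
          Nonempty (MultLattice.LocalizedLattice m ≃*o MultLattice.ROne) := by
  refine ⟨fun h m hm =>
    MultLattice.localizedLattice_classification_of_isSharp hdom hgen hne h hm, fun h =>
    MultLattice.isSharp_of_localizedLattice hdom hgen hfin (fun m hm => ?_) fun m hm => ?_⟩
  · rcases h m hm with ⟨⟨e⟩⟩ | ⟨⟨e⟩⟩
    · exact MultLattice.ZMinus.sharpFactorization.of_mulOrderIso e
    · exact MultLattice.ROne.sharpFactorization.of_mulOrderIso e
  · rcases h m hm with ⟨⟨e⟩⟩ | ⟨⟨e⟩⟩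
    · exact MultLattice.ZMinus.archimedeanPowers.of_mulOrderIso e
    · exact MultLattice.ROne.archimedeanPowers.of_mulOrderIso e
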